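/- \textbf{Setting.} Fix a propositional language: a set of atoms and finitary connectives, in which each of $\wedge,\vee,\to,*,+,\top,\bot,1,0$ is a connective or is expressed by a fixed formula in which every argument occurs at most once; there may be a unary modality $\Box$. Write $\neg\varphi=\varphi\to 0$. A \emph{sequent} $\Gamma\Rightarrow\Delta$ is a pair of finite multisets of formulas, and $(\Gamma\Rightarrow\Delta)\cdot(\Gamma'\Rightarrow\Delta')=(\Gamma,\Gamma'\Rightarrow\Delta,\Delta')$. A formula is \emph{$p$-free} if the atom $p$ does not occur in it. A \emph{rule} consists of finitely many premises and a conclusion, which are sequents built from meta-formulas (formulas over atoms and formula variables), multiset variables (contexts) $\Gamma$, and boxed contexts $\Box\Gamma$; its instances arise by substituting formulas for the formula variables and multisets of formulas for the contexts. A \emph{calculus} is a set of rules; $G\vdash S$ means that $S$ has a finite proof tree in $G$. $\mathbf{CFL_e}$ is the multi-conclusion calculus with axioms $\varphi\Rightarrow\varphi$; $\Gamma\Rightarrow\top,\Delta$; $\Gamma,\bot\Rightarrow\Delta$; $\Rightarrow 1$; $0\Rightarrow$, and the usual rules: left $1$, right $0$, left and right additive rules for $\wedge,\vee$ (both versions of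 left $\wedge$ and of right $\vee$), and left and right multiplicative rules for $*,\to,+$. That $H$ \emph{extends} $\mathbf{CFL_e}$ means that all rules of $\mathbf{CFL_e}$ are admissible in $H$: if $H$ proves the premises of an instance, it proves the conclusion. A \emph{left} (resp. \emph{right}) \emph{multi-conclusion semi-analytic rule} has the premises $\Gamma_i,\bar\varphi_{ir}\Rightarrow\bar\psi_{ir},\Delta_i$ ($1\le i\le n$, $1\le r\le m_i$, where $n,m_i\ge 0$) and the conclusion $\Gamma_1,\dots,\Gamma_n,\varphi\Rightarrow\Delta_1,\dots,\Delta_n$ (resp. $\Gamma_1,\dots,\Gamma_n\Rightarrow\varphi,\Delta_1,\dots,\Delta_n$), where the $\Gamma_i,\Delta_i$ are pairwise distinct contexts, $\bar\varphi_{ir},\bar\psi_{ir}$ are multisets of meta-formulas, $\varphi$ is a meta-formula, and every atom and formula variable in $\bar\varphi_{ir},\bar\psi_{ir}$ occurs in $\varphi$. The \emph{modal} semi-analytic rules are $K$: from $\Gamma\Rightarrow\varphi$ infer $\Box\Gamma\Rightarrow\Box\varphi$, and $D$: from $\Gamma\Rightarrow$ infer $\Box\Gamma\Rightarrow$. A set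 of multi-conclusion semi-analytic rules consists of rules of these kinds and contains $K$ if it contains $D$. $H$ is the \emph{axiomatic extension of $G$ by a set $R$ of rules} if the inferences of $H$ are exactly the axioms $S$ with $G\vdash S$ and the instances of the rules in $R$. $H$ is \emph{terminating} if every sequent $S$ is the conclusion of only finitely many inferences of $H$, and there is a well-founded strict order on sequents in which the following lie below $S$: the premises of every inference of $H$ with conclusion $S$ (disregarding the void inference of the empty sequent from itself); every proper subsequent of $S$; and every $(\Gamma,\Pi\Rightarrow\Delta,\Lambda)$ such that $S=(\Gamma,\Box\Pi\Rightarrow\Delta,\Box\Lambda)$ and $\Pi,\Lambda$ are not both empty. A $p$-free formula $I$ is a \emph{strong left $p$-interpolant} of $S$ in $G$ relative to $H$ if $H\vdash S\cdot(I\Rightarrow)$ and, for all $p$-free multisets $\Gamma,\Delta$, $G\vdash S\cdot(\Gamma\Rightarrow\Delta)$ implies $H\vdash\Gamma\Rightarrow I,\Delta$. A $p$-free formula $J$ is a \emph{strong right $p$-interpolant} of $S$ in $G$ relative to $H$ if $H\vdash S\cdot(\Rightarrow J)$ and, for all $p$-free multisets $\Gamma,\Delta$, $G\vdash S\cdot(\Gamma\Rightarrow\Delta)$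 implies $H\vdash J,\Gamma\Rightarrow\Delta$. $G$ has \emph{strong $H$-uniform interpolation} if all sequents have, for every atom $p$, a strong left and a strong right $p$-interpolant in $G$ relative to $H$. \textbf{Theorem.} Let $G$ and $H$ be sequent calculi such that $H$ extends $\mathbf{CFL_e}$, is terminating, and is the axiomatic extension of $G$ by a set of multi-conclusion semi-analytic rules. If $G$ has strong $H$-uniform interpolation, then so does $H$. Moreover, for every sequent $S$ and every atom $p$ there is a single $p$-free formula $\forall pS$ such that $\forall pS$ is a strong left $p$-interpolant and $\neg\forall pS$ is a strong right $p$-interpolant of $S$ in $H$ relative to $H$. -/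

import Mathlib

universe u v

namespace MultiSequent

/-! ### Languages and formulas -/

/-- Logical connectives with their arities. -/
structure Sig where
  Conn : Type u
  arity : Conn → ℕ

/-- Formulas over the signature `L` with atoms from `A`. -/
inductive Formula (L : Sig.{u}) (A : Type v) : Type (max u v)
  | atom (a : A) : Formula L A
  | app (c : L.Conn) (args : Fin (L.arity c) → Formula L A) : Formula L A

namespace Formula

variable {L : Sig.{u}} {A B : Type v}

/-- The multiset of all occurrences of atoms in a formula. -/
def atoms {A : Type v} : Formula L A → Multiset A
  | atom a => {a}
  | app _ args => ∑ i, (args i).atoms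

/-- Simultaneous substitution of formulas for atoms. -/
def subst {A : Type*} {B : Type*} (f : A → Formula L B) : Formula L A → Formula L B
  | atom a => f a
  | app c args => app c (fun i => (args i).subst f)

/-- `p` does not occur in the formula. -/
def Free {A : Type v} (p : A) (φ : Formula L A) : Prop := p ∉ φ.atoms

/-- The application of a unary connective. -/
def unary {A : Type v} (c : {c : L.Conn // L.arity c = 1}) (φ : Formula L A) : Formula L A :=
  app c.1 (fun _ => φ)

end Formula

/-- The connectives of the language of `CFL_e`; `zero` and `one` are the multiplicative constants. -/
inductive BaseConn
  | top | bot | one | zero | conj | disj | imp | fusion | plus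

/-- The arity of the basic connectives. -/
def BaseConn.arity : BaseConn → ℕ
  | .top | .bot | .one | .zero => 0
  | .conj | .disj | .imp | .fusion | .plus => 2

/-- A propositional language: arbitrary connectives, together with a translation that assigns to
every connective of `CFL_e` a formula of the language in which each argument occurs at most once
(a primitive connective of the language, for instance). The language may have a modality `□`. -/
structure PropLang extends Sig.{u} where
  translation : (c : BaseConn) → Formula toSig (Fin c.arity)
  linear : ∀ c, (translation c).atoms.Nodup
  box : Option {c : Conn // arity c = 1}

section Connectives

variable (L : PropLang.{u}) {A : Type v}

def PropLang.top : Formula L.toSig A := (L.translation .top).subst Fin.elim0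
def PropLang.bot : Formula L.toSig A := (L.translation .bot).subst Fin.elim0
def PropLang.one : Formula L.toSig A := (L.translation .one).subst Fin.elim0
def PropLang.zero : Formula L.toSig A := (L.translation .zero).subst Fin.elim0
def PropLang.conj (φ ψ : Formula L.toSig A) : Formula L.toSig A :=
  (L.translation .conj).subst ![φ, ψ]
def PropLang.disj (φ ψ : Formula L.toSig A) : Formula L.toSig A :=
  (L.translation .disj).subst ![φ, ψ]
def PropLang.imp (φ ψ : Formula L.toSig A) : Formula L.toSig A :=
  (L.translation .imp).subst ![φ, ψ]
def PropLang.fusion (φ ψ : Formula L.toSig A) : Formula L.toSig A :=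
  (L.translation .fusion).subst ![φ, ψ]
def PropLang.plus (φ ψ : Formula L.toSig A) : Formula L.toSig A :=
  (L.translation .plus).subst ![φ, ψ]

/-- Negation: `¬ φ` is `φ → 0`. -/
def PropLang.neg (φ : Formula L.toSig A) : Formula L.toSig A := L.imp φ L.zero

end Connectives

/-! ### Sequents and meta-sequents -/

/-- Pairs of multisets `ant ⇒ suc`. -/
@[ext]
structure Seq (α : Type*) where
  ant : Multiset α
  suc : Multiset α

infix:45 " ⇒ₛ " => Seq.mk

namespace Seq

variable {α : Type*}

/-- The empty sequent. -/
def empty : Seq α := 0 ⇒ₛ 0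

/-- The product `S · T` of two sequents. -/
def mul (S T : Seq α) : Seq α := S.ant + T.ant ⇒ₛ S.suc + T.suc

/-- `T` is a proper subsequent of `S`. -/
def ProperSub (T S : Seq α) : Prop := T.ant ≤ S.ant ∧ T.suc ≤ S.suc ∧ T ≠ S

end Seq

/-- Multi-conclusion sequents. -/
abbrev Sequent (L : PropLang.{u}) (A : Type v) := Seq (Formula L.toSig A)

/-- Meta-formulas: formulas built from atoms (`Sum.inl`) and formula variables (`Sum.inr`). -/
abbrev MetaFormula (L : PropLang.{u}) (A : Type v) := Formula L.toSig (A ⊕ ℕ)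

/-- The members of a meta-multiset: meta-formulas, meta-multiset variables (contexts) `Γ`, and
boxed contexts `□Γ`. -/
inductive MetaItem (L : PropLang.{u}) (A : Type v) : Type (max u v)
  | fml (φ : MetaFormula L A) : MetaItem L A
  | ctx (X : ℕ) : MetaItem L A
  | boxCtx (b : {c : L.Conn // L.arity c = 1}) (X : ℕ) : MetaItem L A

abbrev MetaSequent (L : PropLang.{u}) (A : Type v) := Seq (MetaItem L A)

/-- What is substituted for the formula variables and for the contexts. -/
structure Assignment (L : PropLang.{u}) (A : Type v) where
  fml : ℕ → Formula L.toSig A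
  ctx : ℕ → Multiset (Formula L.toSig A)

section Instances

variable {L : PropLang.{u}} {A : Type v}

/-- Atoms are left fixed, formula variables are substituted. -/
def MetaFormula.inst (σ : Assignment L A) (φ : MetaFormula L A) : Formula L.toSig A :=
  φ.subst (Sum.elim Formula.atom σ.fml)

def MetaItem.inst (σ : Assignment L A) : MetaItem L A → Multiset (Formula L.toSig A)
  | .fml φ => {MetaFormula.inst σ φ}
  | .ctx X => σ.ctx X
  | .boxCtx b X => (σ.ctx X).map (Formula.unary b)

def MetaSequent.inst (σ : Assignment L A) (S : MetaSequent L A) : Sequent L A :=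
  S.ant.bind (MetaItem.inst σ) ⇒ₛ S.suc.bind (MetaItem.inst σ)

end Instances

/-! ### Rules and calculi -/

/-- A rule: finitely many premises and a conclusion, all of them meta-sequents. -/
structure Rule (L : PropLang.{u}) (A : Type v) where
  premises : Multiset (MetaSequent L A)
  concl : MetaSequent L A

/-- A sequent calculus is a set of rules. -/
abbrev Calculus (L : PropLang.{u}) (A : Type v) := Set (Rule L A)

namespace Calculus

variable {L : PropLang.{u}} {A : Type v}

/-- The inference with premises `P` and conclusion `S` is an instance of a rule of `G`. -/
def IsInstance (G : Calculus L A) (P : Multiset (Sequent L A)) (S : Sequent L A) : Prop :=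
  ∃ r ∈ G, ∃ σ : Assignment L A,
    P = r.premises.map (MetaSequent.inst σ) ∧ S = MetaSequent.inst σ r.concl

/-- `S` has a proof tree in `G`. -/
inductive Derivable (G : Calculus L A) : Sequent L A → Prop
  | step {P : Multiset (Sequent L A)} {S : Sequent L A} (h : G.IsInstance P S)
      (hP : ∀ T ∈ P, Derivable G T) : Derivable G S

/-- `H` extends `G`: the rules of `G` are available in `H`, i.e. the sequents derivable in `H` are
closed under all rules of `G` (in particular they include all sequents derivable in `G`). -/
def Extends (H G : Calculus L A) : Prop :=
  ∀ P S, G.IsInstance P S → (∀ T ∈ P, H.Derivable T) → H.Derivable S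

/-- `H` is the axiomatic extension of `G` by the rules `R`: the inferences of `H` are the axioms
`S` with `S` derivable in `G`, and the instances of the rules in `R`. -/
def IsAxiomaticExtension (H G R : Calculus L A) : Prop :=
  ∀ P S, H.IsInstance P S ↔ (P = 0 ∧ G.Derivable S) ∨ R.IsInstance P S

/-- Termination. The void inference of the empty sequent from itself, which is an instance of the
rule `D` because `□∅ = ∅`, is disregarded in the second condition. -/
def IsTerminating (H : Calculus L A) : Prop :=
  (∀ S, {P | H.IsInstance P S}.Finite) ∧
  ∃ lt : Sequent L A → Sequent L A → Prop, WellFounded lt ∧ IsTrans (Sequent L A) lt ∧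
    (∀ P S, H.IsInstance P S → ∀ T ∈ P, ¬ (T = Seq.empty ∧ S = Seq.empty) → lt T S) ∧
    (∀ S T : Sequent L A, T.ProperSub S → lt T S) ∧
    (∀ b ∈ L.box, ∀ Γ Ξ Δ Λ : Multiset (Formula L.toSig A), Ξ + Λ ≠ 0 →
      lt (Γ + Ξ ⇒ₛ Δ + Λ)
        (Γ + Ξ.map (Formula.unary b) ⇒ₛ Δ + Λ.map (Formula.unary b)))

end Calculus

/-! ### The calculus `CFL_e` -/

section CFLe

variable (L : PropLang.{u}) (A : Type v)

/-- The rules of `CFL_e`. The formula variables are `φ = 0`, `ψ = 1`; the contexts are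
`Γ = 0`, `Θ = 1`, `Δ = 2`, `Λ = 3`. -/
inductive IsCFLeRule : Rule L A → Prop
  | id : IsCFLeRule ⟨0, {.fml (.atom (.inr 0))} ⇒ₛ {.fml (.atom (.inr 0))}⟩
  | top_right : IsCFLeRule ⟨0, {.ctx 0} ⇒ₛ {.fml L.top, .ctx 2}⟩
  | bot_left : IsCFLeRule ⟨0, {.ctx 0, .fml L.bot} ⇒ₛ {.ctx 2}⟩
  | one_right : IsCFLeRule ⟨0, 0 ⇒ₛ {.fml L.one}⟩
  | zero_left : IsCFLeRule ⟨0, {.fml L.zero} ⇒ₛ 0⟩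
  | one_left : IsCFLeRule
      ⟨{{.ctx 0} ⇒ₛ {.ctx 2}},
        {.ctx 0, .fml L.one} ⇒ₛ {.ctx 2}⟩
  | zero_right : IsCFLeRule
      ⟨{{.ctx 0} ⇒ₛ {.ctx 2}},
        {.ctx 0} ⇒ₛ {.fml L.zero, .ctx 2}⟩
  | conj_left₁ : IsCFLeRule
      ⟨{{.ctx 0, .fml (.atom (.inr 0))} ⇒ₛ {.ctx 2}},
        {.ctx 0, .fml (L.conj (.atom (.inr 0)) (.atom (.inr 1)))} ⇒ₛ {.ctx 2}⟩
  | conj_left₂ : IsCFLeRule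
      ⟨{{.ctx 0, .fml (.atom (.inr 1))} ⇒ₛ {.ctx 2}},
        {.ctx 0, .fml (L.conj (.atom (.inr 0)) (.atom (.inr 1)))} ⇒ₛ {.ctx 2}⟩
  | conj_right : IsCFLeRule
      ⟨{{.ctx 0} ⇒ₛ {.fml (.atom (.inr 0)), .ctx 2},
        {.ctx 0} ⇒ₛ {.fml (.atom (.inr 1)), .ctx 2}},
        {.ctx 0} ⇒ₛ {.fml (L.conj (.atom (.inr 0)) (.atom (.inr 1))), .ctx 2}⟩
  | disj_left : IsCFLeRule
      ⟨{{.ctx 0, .fml (.atom (.inr 0))} ⇒ₛ {.ctx 2},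
        {.ctx 0, .fml (.atom (.inr 1))} ⇒ₛ {.ctx 2}},
        {.ctx 0, .fml (L.disj (.atom (.inr 0)) (.atom (.inr 1)))} ⇒ₛ {.ctx 2}⟩
  | disj_right₁ : IsCFLeRule
      ⟨{{.ctx 0} ⇒ₛ {.fml (.atom (.inr 0)), .ctx 2}},
        {.ctx 0} ⇒ₛ {.fml (L.disj (.atom (.inr 0)) (.atom (.inr 1))), .ctx 2}⟩
  | disj_right₂ : IsCFLeRule
      ⟨{{.ctx 0} ⇒ₛ {.fml (.atom (.inr 1)), .ctx 2}},
        {.ctx 0} ⇒ₛ {.fml (L.disj (.atom (.inr 0)) (.atom (.inr 1))), .ctx 2}⟩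
  | fusion_left : IsCFLeRule
      ⟨{{.ctx 0, .fml (.atom (.inr 0)), .fml (.atom (.inr 1))} ⇒ₛ {.ctx 2}},
        {.ctx 0, .fml (L.fusion (.atom (.inr 0)) (.atom (.inr 1)))} ⇒ₛ {.ctx 2}⟩
  | fusion_right : IsCFLeRule
      ⟨{{.ctx 0} ⇒ₛ {.fml (.atom (.inr 0)), .ctx 2},
        {.ctx 1} ⇒ₛ {.fml (.atom (.inr 1)), .ctx 3}},
        {.ctx 0, .ctx 1} ⇒ₛ
          {.fml (L.fusion (.atom (.inr 0)) (.atom (.inr 1))), .ctx 2, .ctx 3}⟩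
  | imp_left : IsCFLeRule
      ⟨{{.ctx 0} ⇒ₛ {.fml (.atom (.inr 0)), .ctx 2},
        {.ctx 1, .fml (.atom (.inr 1))} ⇒ₛ {.ctx 3}},
        {.ctx 0, .ctx 1, .fml (L.imp (.atom (.inr 0)) (.atom (.inr 1)))} ⇒ₛ
          {.ctx 2, .ctx 3}⟩
  | imp_right : IsCFLeRule
      ⟨{{.ctx 0, .fml (.atom (.inr 0))} ⇒ₛ {.fml (.atom (.inr 1)), .ctx 2}},
        {.ctx 0} ⇒ₛ {.fml (L.imp (.atom (.inr 0)) (.atom (.inr 1))), .ctx 2}⟩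
  | plus_left : IsCFLeRule
      ⟨{{.ctx 0, .fml (.atom (.inr 0))} ⇒ₛ {.ctx 2},
        {.ctx 1, .fml (.atom (.inr 1))} ⇒ₛ {.ctx 3}},
        {.ctx 0, .ctx 1, .fml (L.plus (.atom (.inr 0)) (.atom (.inr 1)))} ⇒ₛ
          {.ctx 2, .ctx 3}⟩
  | plus_right : IsCFLeRule
      ⟨{{.ctx 0} ⇒ₛ {.fml (.atom (.inr 0)), .fml (.atom (.inr 1)), .ctx 2}},
        {.ctx 0} ⇒ₛ {.fml (L.plus (.atom (.inr 0)) (.atom (.inr 1))), .ctx 2}⟩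

/-- The multi-conclusion calculus `CFL_e`. -/
def CFLe : Calculus L A := {r | IsCFLeRule L A r}

end CFLe

/-! ### Multi-conclusion semi-analytic rules -/

section SemiAnalytic

variable {L : PropLang.{u}} {A : Type v}

/-- The data shared by left and right multi-conclusion semi-analytic rules: the contexts `Γ i` and
`Δ i`, which are pairwise distinct variables, for every `i` the (possibly empty) family of pairs
`(φ̄, ψ̄)` giving the premises `Γ i, φ̄ ⇒ ψ̄, Δ i`, and the main meta-formula. -/
structure SemiAnalyticData (L : PropLang.{u}) (A : Type v) where
  n : ℕ
  Γ : Fin n → ℕ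
  Δ : Fin n → ℕ
  distinct : Function.Injective (Sum.elim Γ Δ)
  blocks : Fin n → Multiset (Multiset (MetaFormula L A) × Multiset (MetaFormula L A))
  main : MetaFormula L A
  /-- The occurrence preserving condition. -/
  occurrence : ∀ i, ∀ q ∈ blocks i, ∀ χ ∈ q.1 + q.2, χ.atoms ⊆ main.atoms

/-- The premises `Γ i, φ̄ ⇒ ψ̄, Δ i`. -/
def SemiAnalyticData.premises (d : SemiAnalyticData L A) : Multiset (MetaSequent L A) :=
  ∑ i, (d.blocks i).map (fun q =>
    MetaItem.ctx (d.Γ i) ::ₘ q.1.map MetaItem.fml ⇒ₛ MetaItem.ctx (d.Δ i) ::ₘ q.2.map MetaItem.fml)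

/-- Conclusion `Γ₁, …, Γₙ, φ ⇒ Δ₁, …, Δₙ`. -/
def IsLeftSemiAnalytic (r : Rule L A) : Prop :=
  ∃ d : SemiAnalyticData L A, r = ⟨d.premises,
    .fml d.main ::ₘ ∑ i, {.ctx (d.Γ i)} ⇒ₛ ∑ i, {.ctx (d.Δ i)}⟩

/-- Conclusion `Γ₁, …, Γₙ ⇒ φ, Δ₁, …, Δₙ`. -/
def IsRightSemiAnalytic (r : Rule L A) : Prop :=
  ∃ d : SemiAnalyticData L A, r = ⟨d.premises,
    ∑ i, {.ctx (d.Γ i)} ⇒ₛ .fml d.main ::ₘ ∑ i, {.ctx (d.Δ i)}⟩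

/-- The rule `K`: from `Γ ⇒ φ` infer `□Γ ⇒ □φ`. -/
def ruleK (b : {c : L.Conn // L.arity c = 1}) (X x : ℕ) : Rule L A :=
  ⟨{{.ctx X} ⇒ₛ {.fml (.atom (.inr x))}},
    {.boxCtx b X} ⇒ₛ {.fml (.unary b (.atom (.inr x)))}⟩

/-- The rule `D`: from `Γ ⇒` infer `□Γ ⇒`. -/
def ruleD (b : {c : L.Conn // L.arity c = 1}) (X : ℕ) : Rule L A :=
  ⟨{{.ctx X} ⇒ₛ 0}, {.boxCtx b X} ⇒ₛ 0⟩

def IsModalSemiAnalytic (r : Rule L A) : Prop :=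
  ∃ b ∈ L.box, (∃ X x, r = ruleK b X x) ∨ (∃ X, r = ruleD b X)

/-- `R` consists of multi-conclusion semi-analytic rules, and contains `K` if it contains `D`. -/
def Calculus.IsSemiAnalytic (R : Calculus L A) : Prop :=
  (∀ r ∈ R, IsLeftSemiAnalytic r ∨ IsRightSemiAnalytic r ∨ IsModalSemiAnalytic r) ∧
  ∀ b ∈ L.box, (∃ X, ruleD b X ∈ R) → ∃ X x, ruleK b X x ∈ R

end SemiAnalytic

/-! ### Strong uniform interpolation -/

section Interpolation

variable {L : PropLang.{u}} {A : Type v}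

/-- `I` is a strong left `p`-interpolant of `S` in `G` relative to `H`. -/
def IsStrongLeftInterpolant (G H : Calculus L A) (p : A) (S : Sequent L A)
    (I : Formula L.toSig A) : Prop :=
  I.Free p ∧ H.Derivable (S.mul ({I} ⇒ₛ 0)) ∧
  ∀ Γ Δ : Multiset (Formula L.toSig A), (∀ φ ∈ Γ, φ.Free p) → (∀ φ ∈ Δ, φ.Free p) →
    G.Derivable (S.mul (Γ ⇒ₛ Δ)) → H.Derivable (Γ ⇒ₛ I ::ₘ Δ)

/-- `J` is a strong right `p`-interpolant of `T` in `G` relative to `H`. -/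
def IsStrongRightInterpolant (G H : Calculus L A) (p : A) (T : Sequent L A)
    (J : Formula L.toSig A) : Prop :=
  J.Free p ∧ H.Derivable (T.mul (0 ⇒ₛ {J})) ∧
  ∀ Γ Δ : Multiset (Formula L.toSig A), (∀ φ ∈ Γ, φ.Free p) → (∀ φ ∈ Δ, φ.Free p) →
    G.Derivable (T.mul (Γ ⇒ₛ Δ)) → H.Derivable (J ::ₘ Γ ⇒ₛ Δ)

/-- `G` has strong `H`-uniform interpolation. -/
def Calculus.HasStrongUniformInterpolation (G H : Calculus L A) : Prop :=
  ∀ (S T : Sequent L A) (p : A),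
    (∃ I, IsStrongLeftInterpolant G H p S I) ∧ ∃ J, IsStrongRightInterpolant G H p T J

end Interpolation

end MultiSequent

namespace MultiSequent

/-! ### Formulas -/

namespace Formula

variable {L : Sig.{u}}

/-! For each sequent S one constructs a single p-free formula I, a cover: S·(I ⇒) is derivable in H,
and T·(⇒ I) is derivable for every p-free T with S·T derivable in H. This is a left interpolant, and
¬I is a right one because the negation rules move I across the arrow
(`IsStrongLeftInterpolant.neg`). Cut is never used.

The construction recurses along the terminating order (`covers_derivable`). The possible last
inferences of a proof of S·T give six families of T, each with its own cover J built from covers of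
smaller sequents; their disjunction is I. If S·T is an axiom, the interpolant in G serves. If the
main formula of a semi-analytic rule lies in S, the cover is a fusion over the blocks of
conjunctions over the premises, each premise restricted to its part coming from S
(`covers_main_left`). If it lies in T, the occurrence condition makes the active formulas p-free, so
they count as part of T. When S is spread over several blocks, its parts are proper subsequents, and
the cover is the + of their covers (`covers_main_right`). The modal rules contribute □J and ¬□¬J
(`covers_K_left`, `covers_K_right`, `covers_D`).

One case makes no progress on S: the main formula lies in T and S lies whole in one block. There an
inner induction on the proof of S·T helps: I is added to the succedent context of that block and the
same rule is applied again (`BlockRule.derivable_self`, `exists_isCover_of_below`).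

Disjunctions must be finite although the set of rules need not be. Termination bounds the premise
multisets, and blocks without premises, whose number it does not bound, can be merged
(`exists_merge`). -/

theorem mem_atoms_subst {A B : Type*} (f : A → Formula L B) (b : B) (φ : Formula L A) :
    b ∈ (φ.subst f).atoms ↔ ∃ a ∈ φ.atoms, b ∈ (f a).atoms := by
  induction φ with
  | atom a => simp [subst, atoms]
  | app c args ih =>
    simp only [subst, atoms, Multiset.mem_sum, Finset.mem_univ, true_and, ih]
    constructor
    · rintro ⟨i, a, ha, hb⟩
      exact ⟨a, ⟨i, ha⟩, hb⟩
    · rintro ⟨a, ⟨i, ha⟩, hb⟩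
      exact ⟨i, a, ha, hb⟩

theorem subst_subst {A B C : Type*} (f : A → Formula L B) (g : B → Formula L C)
    (φ : Formula L A) : (φ.subst f).subst g = φ.subst (fun a => (f a).subst g) := by
  induction φ with
  | atom a => rfl
  | app c args ih => simp only [subst, ih]

theorem unary_injective {A : Type v} (c : {c : L.Conn // L.arity c = 1}) :
    Function.Injective (unary (A := A) c) := by
  intro φ ψ h
  simp only [unary, app.injEq, heq_eq_eq, true_and] at h
  exact congrFun h ⟨0, by rw [c.2]; exact Nat.one_pos⟩

theorem free_unary {A : Type v} (c : {c : L.Conn // L.arity c = 1}) (p : A) (φ : Formula L A) :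
    (unary c φ).Free p ↔ φ.Free p := by
  have : ∃ _ : Fin (L.arity c.1), True := ⟨⟨0, by rw [c.2]; exact Nat.one_pos⟩, trivial⟩
  have : Nonempty (Fin (L.arity c.1)) := ⟨this.choose⟩
  simp only [Free, unary, atoms, Multiset.mem_sum, Finset.mem_univ, true_and, exists_const]

theorem subst_free {A B : Type*} {f : A → Formula L B} {p : B} (h : ∀ a, (f a).Free p)
    (φ : Formula L A) : (φ.subst f).Free p := by
  rw [Free, mem_atoms_subst]
  rintro ⟨a, -, ha⟩
  exact h a ha

end Formula

/-! ### Freeness of the defined connectives. -/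

section ConnectiveLemmas

variable (L : PropLang.{u}) {A : Type v} {p : A} {φ ψ : Formula L.toSig A}

theorem PropLang.free_top : (L.top : Formula L.toSig A).Free p :=
  Formula.subst_free (fun a : Fin 0 => a.elim0) _

theorem PropLang.free_bot : (L.bot : Formula L.toSig A).Free p :=
  Formula.subst_free (fun a : Fin 0 => a.elim0) _

theorem PropLang.free_one : (L.one : Formula L.toSig A).Free p :=
  Formula.subst_free (fun a : Fin 0 => a.elim0) _

theorem PropLang.free_zero : (L.zero : Formula L.toSig A).Free p :=
  Formula.subst_free (fun a : Fin 0 => a.elim0) _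

variable {L}

theorem free_pair (hφ : φ.Free p) (hψ : ψ.Free p) (i : Fin 2) : (![φ, ψ] i).Free p := by
  fin_cases i
  · exact hφ
  · exact hψ

theorem PropLang.free_conj (hφ : φ.Free p) (hψ : ψ.Free p) : (L.conj φ ψ).Free p :=
  Formula.subst_free (free_pair hφ hψ) _

theorem PropLang.free_disj (hφ : φ.Free p) (hψ : ψ.Free p) : (L.disj φ ψ).Free p :=
  Formula.subst_free (free_pair hφ hψ) _

theorem PropLang.free_fusion (hφ : φ.Free p) (hψ : ψ.Free p) : (L.fusion φ ψ).Free p :=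
  Formula.subst_free (free_pair hφ hψ) _

theorem PropLang.free_plus (hφ : φ.Free p) (hψ : ψ.Free p) : (L.plus φ ψ).Free p :=
  Formula.subst_free (free_pair hφ hψ) _

theorem PropLang.free_neg (hφ : φ.Free p) : (L.neg φ).Free p :=
  Formula.subst_free (free_pair hφ L.free_zero) _

end ConnectiveLemmas

/-! ### The monoid of sequents -/

namespace Seq

variable {α : Type*}

instance : Zero (Seq α) := ⟨empty⟩
instance : Add (Seq α) := ⟨mul⟩

@[simp] theorem ant_zero : (0 : Seq α).ant = 0 := rfl
@[simp] theorem suc_zero : (0 : Seq α).suc = 0 := rfl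
@[simp] theorem ant_add (S T : Seq α) : (S + T).ant = S.ant + T.ant := rfl
@[simp] theorem suc_add (S T : Seq α) : (S + T).suc = S.suc + T.suc := rfl

/-- Writing the product additively makes finite sums over blocks available. Cancellation later shows
that if one block contains all of S, the others contain nothing of it. -/
instance : AddCancelCommMonoid (Seq α) where
  add_assoc S T U := Seq.ext (add_assoc _ _ _) (add_assoc _ _ _)
  zero_add S := Seq.ext (zero_add _) (zero_add _)
  add_zero S := Seq.ext (add_zero _) (add_zero _)
  add_comm S T := Seq.ext (add_comm _ _) (add_comm _ _)
  nsmul := nsmulRec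
  add_left_cancel S T U h :=
    Seq.ext (add_left_cancel (congrArg ant h)) (add_left_cancel (congrArg suc h))

/-- The antecedent, as a homomorphism. -/
def antHom : Seq α →+ Multiset α := ⟨⟨ant, rfl⟩, fun _ _ => rfl⟩

/-- The succedent, as a homomorphism. -/
def sucHom : Seq α →+ Multiset α := ⟨⟨suc, rfl⟩, fun _ _ => rfl⟩

@[simp] theorem ant_sum {ι : Type*} (s : Finset ι) (f : ι → Seq α) :
    (∑ i ∈ s, f i).ant = ∑ i ∈ s, (f i).ant := map_sum antHom f s

@[simp] theorem suc_sum {ι : Type*} (s : Finset ι) (f : ι → Seq α) :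
    (∑ i ∈ s, f i).suc = ∑ i ∈ s, (f i).suc := map_sum sucHom f s

/-- The sequent `φ ⇒`. -/
def left (φ : α) : Seq α := {φ} ⇒ₛ 0

/-- The sequent `⇒ φ`. -/
def right (φ : α) : Seq α := 0 ⇒ₛ {φ}

@[simp] theorem ant_left (φ : α) : (left φ).ant = {φ} := rfl
@[simp] theorem suc_left (φ : α) : (left φ).suc = 0 := rfl
@[simp] theorem ant_right (φ : α) : (right φ).ant = 0 := rfl
@[simp] theorem suc_right (φ : α) : (right φ).suc = {φ} := rfl

theorem eq_zero_of_add_eq_zero {S T : Seq α} (h : S + T = 0) : S = 0 := by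
  have h1 := congrArg ant h
  have h2 := congrArg suc h
  simp only [ant_add, suc_add, ant_zero, suc_zero, add_eq_zero] at h1 h2
  exact Seq.ext h1.1 h2.1

theorem eq_zero_of_sum_eq_zero {ι : Type*} {s : Finset ι} {f : ι → Seq α}
    (h : ∑ i ∈ s, f i = 0) {i : ι} (hi : i ∈ s) : f i = 0 := by
  classical
  rw [← Finset.add_sum_erase s f hi] at h
  exact eq_zero_of_add_eq_zero h

/-- Riesz refinement: let `a₁ = a ∩ s` be as large as possible; the other three pieces are then
forced. -/
theorem _root_.Multiset.exists_refinement {a b s t : Multiset α} (h : a + b = s + t) :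
    ∃ a₁ a₂ b₁ b₂, a = a₁ + a₂ ∧ b = b₁ + b₂ ∧ s = a₁ + b₁ ∧ t = a₂ + b₂ := by
  classical
  refine ⟨a ∩ s, a - s, s - a, t - (a - s), ?_, ?_, ?_, ?_⟩ <;>
  · ext x
    have := congrArg (Multiset.count x) h
    simp only [Multiset.count_add, Multiset.count_inter, Multiset.count_sub] at *
    omega

theorem exists_refinement {a b s t : Seq α} (h : a + b = s + t) :
    ∃ a₁ a₂ b₁ b₂, a = a₁ + a₂ ∧ b = b₁ + b₂ ∧ s = a₁ + b₁ ∧ t = a₂ + b₂ := by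
  obtain ⟨a₁, a₂, b₁, b₂, h1, h2, h3, h4⟩ := Multiset.exists_refinement (congrArg ant h)
  obtain ⟨c₁, c₂, d₁, d₂, k1, k2, k3, k4⟩ := Multiset.exists_refinement (congrArg suc h)
  exact ⟨a₁ ⇒ₛ c₁, a₂ ⇒ₛ c₂, b₁ ⇒ₛ d₁, b₂ ⇒ₛ d₂, Seq.ext h1 k1, Seq.ext h2 k2, Seq.ext h3 k3,
    Seq.ext h4 k4⟩

/-- Iterated refinement. It divides the context of every block of an inference with conclusion S·T
into the share of S and the share of T. -/
theorem exists_sum_refinement {ι : Type*} (s : Finset ι) (C : ι → Seq α) {S T : Seq α}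
    (h : ∑ i ∈ s, C i = S + T) :
    ∃ X Y : ι → Seq α, (∀ i ∈ s, C i = X i + Y i) ∧ S = ∑ i ∈ s, X i ∧ T = ∑ i ∈ s, Y i := by
  classical
  induction s using Finset.induction_on generalizing S T with
  | empty =>
    rw [Finset.sum_empty] at h
    refine ⟨fun _ => 0, fun _ => 0, by simp, ?_, ?_⟩
    · simpa using eq_zero_of_add_eq_zero h.symm
    · rw [add_comm] at h
      simpa using eq_zero_of_add_eq_zero h.symm
  | insert i s hi ih =>
    rw [Finset.sum_insert hi] at h
    obtain ⟨a₁, a₂, b₁, b₂, h1, h2, rfl, rfl⟩ := exists_refinement h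
    obtain ⟨X, Y, hXY, rfl, rfl⟩ := ih h2
    have hne : ∀ j ∈ s, j ≠ i := fun j hj e => hi (e ▸ hj)
    refine ⟨Function.update X i a₁, Function.update Y i a₂, ?_, ?_, ?_⟩
    · intro j hj
      rcases Finset.mem_insert.1 hj with rfl | hj
      · simpa using h1
      · simpa [hne j hj] using hXY j hj
    · rw [Finset.sum_insert hi, Function.update_self]
      exact congrArg _ (Finset.sum_congr rfl fun j hj => by simp [hne j hj])
    · rw [Finset.sum_insert hi, Function.update_self]
      exact congrArg _ (Finset.sum_congr rfl fun j hj => by simp [hne j hj])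

end Seq

/-! ### The rules of `CFL_e` as closure conditions -/

open MultiSequent.Seq (left right)

section Closure

variable {L : PropLang.{u}} {A : Type v} {H : Calculus L A}

theorem MetaFormula.inst_var (σ : Assignment L A) (n : ℕ) :
    MetaFormula.inst σ (.atom (.inr n)) = σ.fml n := rfl

theorem MetaFormula.inst_const (σ : Assignment L A) (χ : Formula L.toSig (Fin 0)) :
    MetaFormula.inst σ (χ.subst Fin.elim0) = χ.subst Fin.elim0 := by
  rw [MetaFormula.inst, Formula.subst_subst]
  exact congrArg (fun f => χ.subst f) (funext fun a => a.elim0)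

theorem MetaFormula.inst_binary (σ : Assignment L A) (χ : Formula L.toSig (Fin 2))
    (m n : ℕ) : MetaFormula.inst σ (χ.subst ![.atom (.inr m), .atom (.inr n)]) =
      χ.subst ![σ.fml m, σ.fml n] := by
  rw [MetaFormula.inst, Formula.subst_subst]
  refine congrArg (fun f => χ.subst f) (funext fun a => ?_)
  fin_cases a <;> rfl

theorem inst_top (σ : Assignment L A) : MetaFormula.inst σ L.top = L.top :=
  MetaFormula.inst_const σ _
theorem inst_bot (σ : Assignment L A) : MetaFormula.inst σ L.bot = L.bot :=
  MetaFormula.inst_const σ _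
theorem inst_one (σ : Assignment L A) : MetaFormula.inst σ L.one = L.one :=
  MetaFormula.inst_const σ _
theorem inst_zero (σ : Assignment L A) : MetaFormula.inst σ L.zero = L.zero :=
  MetaFormula.inst_const σ _
theorem inst_conj (σ : Assignment L A) (m n : ℕ) :
    MetaFormula.inst σ (L.conj (.atom (.inr m)) (.atom (.inr n))) =
      L.conj (σ.fml m) (σ.fml n) := MetaFormula.inst_binary σ _ m n
theorem inst_disj (σ : Assignment L A) (m n : ℕ) :
    MetaFormula.inst σ (L.disj (.atom (.inr m)) (.atom (.inr n))) =
      L.disj (σ.fml m) (σ.fml n) := MetaFormula.inst_binary σ _ m n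
theorem inst_imp (σ : Assignment L A) (m n : ℕ) :
    MetaFormula.inst σ (L.imp (.atom (.inr m)) (.atom (.inr n))) =
      L.imp (σ.fml m) (σ.fml n) := MetaFormula.inst_binary σ _ m n
theorem inst_fusion (σ : Assignment L A) (m n : ℕ) :
    MetaFormula.inst σ (L.fusion (.atom (.inr m)) (.atom (.inr n))) =
      L.fusion (σ.fml m) (σ.fml n) := MetaFormula.inst_binary σ _ m n
theorem inst_plus (σ : Assignment L A) (m n : ℕ) :
    MetaFormula.inst σ (L.plus (.atom (.inr m)) (.atom (.inr n))) =
      L.plus (σ.fml m) (σ.fml n) := MetaFormula.inst_binary σ _ m n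

/-- The assignment of `φ`, `ψ` to the formula variables and of `S`, `T` to the contexts of a rule of
`CFL_e`. -/
def stdAssignment (φ ψ : Formula L.toSig A) (S T : Sequent L A) : Assignment L A where
  fml n := if n = 0 then φ else ψ
  ctx n := if n = 0 then S.ant else if n = 1 then T.ant else if n = 2 then S.suc else T.suc

theorem Calculus.Extends.apply (h : H.Extends (CFLe L A)) {r : Rule L A} (hr : IsCFLeRule L A r)
    (σ : Assignment L A) (hP : ∀ T ∈ r.premises, H.Derivable (MetaSequent.inst σ T)) :
    H.Derivable (MetaSequent.inst σ r.concl) :=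
  h _ _ ⟨r, hr, σ, rfl, rfl⟩ (by simpa using hP)

theorem Seq.add_def {α : Type*} (S T : Seq α) : S + T = (S.ant + T.ant ⇒ₛ S.suc + T.suc) := rfl

end Closure

section Rules

variable {L : PropLang.{u}} {A : Type v} {H : Calculus L A}

attribute [local simp] stdAssignment MetaSequent.inst MetaItem.inst MetaFormula.inst_var inst_top
  inst_bot inst_one inst_zero inst_conj inst_disj inst_imp inst_fusion inst_plus Seq.add_def
  add_assoc add_comm add_left_comm Multiset.cons_swap

namespace Calculus.Extends

theorem top_right (h : H.Extends (CFLe L A)) (T : Sequent L A) :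
    H.Derivable (T + right L.top) := by
  simpa using h.apply .top_right (stdAssignment L.top L.top T T) (by simp)

theorem bot_left (h : H.Extends (CFLe L A)) (T : Sequent L A) :
    H.Derivable (T + left L.bot) := by
  simpa using h.apply .bot_left (stdAssignment L.top L.top T T) (by simp)

theorem one_right (h : H.Extends (CFLe L A)) :
    H.Derivable (right L.one) := by
  simpa [right] using h.apply .one_right (stdAssignment L.top L.top 0 0) (by simp)

theorem zero_left (h : H.Extends (CFLe L A)) :
    H.Derivable (left L.zero) := by
  simpa [left] using h.apply .zero_left (stdAssignment L.top L.top 0 0) (by simp)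

theorem one_left (h : H.Extends (CFLe L A)) {T : Sequent L A}
    (h₁ : H.Derivable (T)) :
    H.Derivable (T + left L.one) := by
  simpa using h.apply .one_left (stdAssignment L.top L.top T T) (by simpa using h₁)

theorem zero_right (h : H.Extends (CFLe L A)) {T : Sequent L A}
    (h₁ : H.Derivable (T)) :
    H.Derivable (T + right L.zero) := by
  simpa using h.apply .zero_right (stdAssignment L.top L.top T T) (by simpa using h₁)

theorem conj_left₁ (h : H.Extends (CFLe L A)) {T : Sequent L A} {φ ψ : Formula L.toSig A}
    (h₁ : H.Derivable (T + left φ)) :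
    H.Derivable (T + left (L.conj φ ψ)) := by
  simpa using h.apply .conj_left₁ (stdAssignment φ ψ T T) (by simpa using h₁)

theorem conj_left₂ (h : H.Extends (CFLe L A)) {T : Sequent L A} {φ ψ : Formula L.toSig A}
    (h₁ : H.Derivable (T + left ψ)) :
    H.Derivable (T + left (L.conj φ ψ)) := by
  simpa using h.apply .conj_left₂ (stdAssignment φ ψ T T) (by simpa using h₁)

theorem conj_right (h : H.Extends (CFLe L A)) {T : Sequent L A} {φ ψ : Formula L.toSig A}
    (h₁ : H.Derivable (T + right φ)) (h₂ : H.Derivable (T + right ψ)) :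
    H.Derivable (T + right (L.conj φ ψ)) := by
  simpa using h.apply .conj_right (stdAssignment φ ψ T T) (by simpa using And.intro h₁ h₂)

theorem disj_left (h : H.Extends (CFLe L A)) {T : Sequent L A} {φ ψ : Formula L.toSig A}
    (h₁ : H.Derivable (T + left φ)) (h₂ : H.Derivable (T + left ψ)) :
    H.Derivable (T + left (L.disj φ ψ)) := by
  simpa using h.apply .disj_left (stdAssignment φ ψ T T) (by simpa using And.intro h₁ h₂)

theorem disj_right₁ (h : H.Extends (CFLe L A)) {T : Sequent L A} {φ ψ : Formula L.toSig A}
    (h₁ : H.Derivable (T + right φ)) :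
    H.Derivable (T + right (L.disj φ ψ)) := by
  simpa using h.apply .disj_right₁ (stdAssignment φ ψ T T) (by simpa using h₁)

theorem disj_right₂ (h : H.Extends (CFLe L A)) {T : Sequent L A} {φ ψ : Formula L.toSig A}
    (h₁ : H.Derivable (T + right ψ)) :
    H.Derivable (T + right (L.disj φ ψ)) := by
  simpa using h.apply .disj_right₂ (stdAssignment φ ψ T T) (by simpa using h₁)

theorem fusion_left (h : H.Extends (CFLe L A)) {T : Sequent L A} {φ ψ : Formula L.toSig A}
    (h₁ : H.Derivable (T + left φ + left ψ)) :
    H.Derivable (T + left (L.fusion φ ψ)) := by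
  simpa using h.apply .fusion_left (stdAssignment φ ψ T T) (by simpa using h₁)

theorem fusion_right (h : H.Extends (CFLe L A)) {S T : Sequent L A} {φ ψ : Formula L.toSig A}
    (h₁ : H.Derivable (S + right φ)) (h₂ : H.Derivable (T + right ψ)) :
    H.Derivable (S + T + right (L.fusion φ ψ)) := by
  simpa using h.apply .fusion_right (stdAssignment φ ψ S T) (by simpa using And.intro h₁ h₂)

theorem imp_left (h : H.Extends (CFLe L A)) {S T : Sequent L A} {φ ψ : Formula L.toSig A}
    (h₁ : H.Derivable (S + right φ)) (h₂ : H.Derivable (T + left ψ)) :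
    H.Derivable (S + T + left (L.imp φ ψ)) := by
  simpa using h.apply .imp_left (stdAssignment φ ψ S T) (by simpa using And.intro h₁ h₂)

theorem imp_right (h : H.Extends (CFLe L A)) {T : Sequent L A} {φ ψ : Formula L.toSig A}
    (h₁ : H.Derivable (T + left φ + right ψ)) :
    H.Derivable (T + right (L.imp φ ψ)) := by
  simpa using h.apply .imp_right (stdAssignment φ ψ T T) (by simpa using h₁)

theorem plus_left (h : H.Extends (CFLe L A)) {S T : Sequent L A} {φ ψ : Formula L.toSig A}
    (h₁ : H.Derivable (S + left φ)) (h₂ : H.Derivable (T + left ψ)) :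
    H.Derivable (S + T + left (L.plus φ ψ)) := by
  simpa using h.apply .plus_left (stdAssignment φ ψ S T) (by simpa using And.intro h₁ h₂)

theorem plus_right (h : H.Extends (CFLe L A)) {T : Sequent L A} {φ ψ : Formula L.toSig A}
    (h₁ : H.Derivable (T + right φ + right ψ)) :
    H.Derivable (T + right (L.plus φ ψ)) := by
  simpa using h.apply .plus_right (stdAssignment φ ψ T T) (by simpa using h₁)

end Calculus.Extends

end Rules

variable {L : PropLang.{u}} {A : Type v}

/-! ### Derived rules and iterated connectives -/

section Derived

variable {H : Calculus L A}

namespace Calculus.Extends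

theorem neg_right (h : H.Extends (CFLe L A)) {T : Sequent L A} {φ : Formula L.toSig A}
    (hT : H.Derivable (T + left φ)) : H.Derivable (T + right (L.neg φ)) :=
  h.imp_right (h.zero_right hT)

theorem neg_left (h : H.Extends (CFLe L A)) {T : Sequent L A} {φ : Formula L.toSig A}
    (hT : H.Derivable (T + right φ)) : H.Derivable (T + left (L.neg φ)) := by
  simpa [PropLang.neg] using h.imp_left (T := 0) hT (by simpa using h.zero_left)

end Calculus.Extends

variable (L) in
/-- Iterated conjunction. -/
def bigConj : List (Formula L.toSig A) → Formula L.toSig A := List.foldr L.conj L.top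

variable (L) in
/-- Iterated fusion. -/
def bigFusion : List (Formula L.toSig A) → Formula L.toSig A := List.foldr L.fusion L.one

variable (L) in
/-- Iterated multiplicative disjunction. -/
def bigPlus : List (Formula L.toSig A) → Formula L.toSig A := List.foldr L.plus L.zero

theorem free_bigConj {p : A} {l : List (Formula L.toSig A)} (hl : ∀ φ ∈ l, φ.Free p) :
    (bigConj L l).Free p := by
  induction l with
  | nil => exact L.free_top
  | cons φ l ih =>
    rw [List.forall_mem_cons] at hl
    exact PropLang.free_conj hl.1 (ih hl.2)

theorem free_bigFusion {p : A} {l : List (Formula L.toSig A)} (hl : ∀ φ ∈ l, φ.Free p) :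
    (bigFusion L l).Free p := by
  induction l with
  | nil => exact L.free_one
  | cons φ l ih =>
    rw [List.forall_mem_cons] at hl
    exact PropLang.free_fusion hl.1 (ih hl.2)

theorem free_bigPlus {p : A} {l : List (Formula L.toSig A)} (hl : ∀ φ ∈ l, φ.Free p) :
    (bigPlus L l).Free p := by
  induction l with
  | nil => exact L.free_zero
  | cons φ l ih =>
    rw [List.forall_mem_cons] at hl
    exact PropLang.free_plus hl.1 (ih hl.2)

namespace Calculus.Extends

theorem bigConj_right (h : H.Extends (CFLe L A)) {T : Sequent L A}
    {l : List (Formula L.toSig A)} (hl : ∀ φ ∈ l, H.Derivable (T + right φ)) :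
    H.Derivable (T + right (bigConj L l)) := by
  induction l with
  | nil => exact h.top_right T
  | cons φ l ih =>
    rw [List.forall_mem_cons] at hl
    exact h.conj_right hl.1 (ih hl.2)

theorem bigConj_left (h : H.Extends (CFLe L A)) {T : Sequent L A} {φ : Formula L.toSig A}
    {l : List (Formula L.toSig A)} (hφ : φ ∈ l) (hT : H.Derivable (T + left φ)) :
    H.Derivable (T + left (bigConj L l)) := by
  induction l with
  | nil => simp at hφ
  | cons ψ l ih =>
    rcases List.mem_cons.1 hφ with rfl | hφ
    · exact h.conj_left₁ hT
    · exact h.conj_left₂ (ih hφ)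

theorem bigFusion_left (h : H.Extends (CFLe L A)) {T : Sequent L A}
    {l : List (Formula L.toSig A)} (hT : H.Derivable (T + (↑l ⇒ₛ 0))) :
    H.Derivable (T + left (bigFusion L l)) := by
  induction l generalizing T with
  | nil =>
    have e : T + ((([] : List (Formula L.toSig A)) : Multiset _) ⇒ₛ 0) = T :=
      Seq.ext (by simp) (by simp)
    rw [e] at hT
    exact h.one_left hT
  | cons φ l ih =>
    refine h.fusion_left (ih ?_)
    convert hT using 1
    exact Seq.ext (by simp [add_assoc, ← Multiset.cons_coe]) (by simp)

/-- The formula depends only on the multiset of labels `K i`, not on the index set, so instances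
with different blocks can share one formula. In the induction, any index carrying the head label may
be split off. -/
theorem bigFusion_right (h : H.Extends (CFLe L A)) {X ι : Type*} {s : Finset ι} {K : ι → X}
    {B : ι → Sequent L A} {c : X → Formula L.toSig A} {l : List X}
    (hl : (l : Multiset X) = s.val.map K)
    (hs : ∀ i ∈ s, H.Derivable (B i + right (c (K i)))) :
    H.Derivable (∑ i ∈ s, B i + right (bigFusion L (l.map c))) := by
  classical
  induction l generalizing s with
  | nil =>
    have : s = ∅ := by simpa using hl.symm
    subst this
    simpa [bigFusion] using h.one_right
  | cons x l ih =>
    have hx : x ∈ s.val.map K := by rw [← hl]; simp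
    obtain ⟨i, hi, rfl⟩ := Multiset.mem_map.1 hx
    rw [← Finset.add_sum_erase s B hi]
    refine h.fusion_right (hs i hi) (ih ?_ fun j hj => hs j (Finset.mem_of_mem_erase hj))
    rw [← Multiset.cons_inj_right (K i), Multiset.cons_coe, hl, Finset.erase_val,
      ← Multiset.map_cons, Multiset.cons_erase hi]

theorem bigPlus_right (h : H.Extends (CFLe L A)) {T : Sequent L A}
    {l : List (Formula L.toSig A)} (hT : H.Derivable (T + (0 ⇒ₛ ↑l))) :
    H.Derivable (T + right (bigPlus L l)) := by
  induction l generalizing T with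
  | nil =>
    have e : T + (0 ⇒ₛ (([] : List (Formula L.toSig A)) : Multiset _)) = T :=
      Seq.ext (by simp) (by simp)
    rw [e] at hT
    exact h.zero_right hT
  | cons φ l ih =>
    refine h.plus_right (ih ?_)
    convert hT using 1
    exact Seq.ext (by simp) (by simp [add_assoc, ← Multiset.cons_coe])

theorem bigPlus_left (h : H.Extends (CFLe L A)) {c : Sequent L A → Formula L.toSig A}
    {l : List (Sequent L A)} (hl : ∀ U ∈ l, H.Derivable (U + left (c U))) :
    H.Derivable (l.sum + left (bigPlus L (l.map c))) := by
  induction l with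
  | nil => simpa [bigPlus] using h.zero_left
  | cons U l ih =>
    rw [List.forall_mem_cons] at hl
    rw [List.sum_cons]
    exact h.plus_left hl.1 (ih hl.2)

end Calculus.Extends

end Derived

/-! ### Covering families of sequents by a single formula -/

/-- All members of the sequent are `p`-free. -/
def Seq.Free (p : A) (T : Sequent L A) : Prop :=
  (∀ φ ∈ T.ant, φ.Free p) ∧ ∀ φ ∈ T.suc, φ.Free p

theorem Seq.free_add {p : A} {S T : Sequent L A} :
    (S + T).Free p ↔ S.Free p ∧ T.Free p := by
  simp only [Seq.Free, Seq.ant_add, Seq.suc_add, Multiset.mem_add, or_imp, forall_and]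
  tauto

theorem Seq.free_of_free_sum {ι : Type*} {p : A} {s : Finset ι} {C : ι → Sequent L A}
    (h : (∑ i ∈ s, C i).Free p) {i : ι} (hi : i ∈ s) : (C i).Free p := by
  classical
  rw [← Finset.add_sum_erase s C hi] at h
  exact (Seq.free_add.1 h).1

section Covers

variable {H : Calculus L A} {p : A} {S : Sequent L A}

/-- `I` is a `p`-free formula with `S · (I ⇒)` derivable, and `T · (⇒ I)` is derivable for
all `p`-free `T` in the family `Q`. -/
structure IsCover (H : Calculus L A) (p : A) (S : Sequent L A) (Q : Sequent L A → Prop)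
    (I : Formula L.toSig A) : Prop where
  free : I.Free p
  sound : H.Derivable (S + left I)
  complete : ∀ T : Sequent L A, T.Free p → Q T → H.Derivable (T + right I)

/-- Some formula covers the family `Q`. -/
def Covers (H : Calculus L A) (p : A) (S : Sequent L A) (Q : Sequent L A → Prop) : Prop :=
  ∃ I, IsCover H p S Q I

theorem isStrongLeftInterpolant_iff {G : Calculus L A} {I : Formula L.toSig A} :
    IsStrongLeftInterpolant G H p S I ↔ IsCover H p S (fun T => G.Derivable (S + T)) I := by
  have e : ∀ T : Sequent L A, T + right I = (T.ant ⇒ₛ I ::ₘ T.suc) := fun T =>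
    Seq.ext (by simp) (by simp [← Multiset.singleton_add, add_comm])
  constructor
  · rintro ⟨h1, h2, h3⟩
    exact ⟨h1, h2, fun T hT hQ => e T ▸ h3 T.ant T.suc hT.1 hT.2 hQ⟩
  · rintro ⟨h1, h2, h3⟩
    exact ⟨h1, h2, fun Γ Δ hΓ hΔ hQ => e (Γ ⇒ₛ Δ) ▸ h3 (Γ ⇒ₛ Δ) ⟨hΓ, hΔ⟩ hQ⟩

/-- The derived negation rules move the interpolant across the arrow in both of its defining
properties. -/
theorem IsStrongLeftInterpolant.neg (h : H.Extends (CFLe L A)) {G : Calculus L A}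
    {I : Formula L.toSig A} (hI : IsStrongLeftInterpolant G H p S I) :
    IsStrongRightInterpolant G H p S (L.neg I) := by
  have hI' := isStrongLeftInterpolant_iff.1 hI
  refine ⟨PropLang.free_neg hI'.free, h.neg_right hI'.sound, fun Γ Δ hΓ hΔ hQ => ?_⟩
  convert h.neg_left (hI'.complete (Γ ⇒ₛ Δ) ⟨hΓ, hΔ⟩ hQ) using 1
  exact Seq.ext (by simp [← Multiset.singleton_add, add_comm]) (by simp)

theorem Covers.mono {Q Q' : Sequent L A → Prop} (hQ : ∀ T, T.Free p → Q' T → Q T)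
    (hc : Covers H p S Q) : Covers H p S Q' :=
  hc.imp fun _ hI => ⟨hI.free, hI.sound, fun T hT hT' => hI.complete T hT (hQ T hT hT')⟩

theorem Covers.of_false (h : H.Extends (CFLe L A)) {Q : Sequent L A → Prop}
    (hQ : ∀ T, T.Free p → ¬ Q T) : Covers H p S Q :=
  ⟨L.bot, L.free_bot, h.bot_left S, fun T hT hT' => (hQ T hT hT').elim⟩

/-- An empty family is covered by ⊥. Otherwise a member may be fixed, and the data witnessing its
membership help to build the cover and prove it sound. -/
theorem Covers.of_exists (h : H.Extends (CFLe L A)) {Q : Sequent L A → Prop}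
    (hQ : ∀ T, T.Free p → Q T → Covers H p S Q) : Covers H p S Q := by
  by_cases hex : ∃ T : Sequent L A, T.Free p ∧ Q T
  · obtain ⟨T, hT, hT'⟩ := hex
    exact hQ T hT hT'
  · exact Covers.of_false h fun T hT hT' => hex ⟨T, hT, hT'⟩

theorem Covers.or (h : H.Extends (CFLe L A)) {Q Q' : Sequent L A → Prop}
    (hc : Covers H p S Q) (hc' : Covers H p S Q') : Covers H p S (fun T => Q T ∨ Q' T) := by
  obtain ⟨I, hI⟩ := hc
  obtain ⟨J, hJ⟩ := hc'
  refine ⟨L.disj I J, PropLang.free_disj hI.free hJ.free, h.disj_left hI.sound hJ.sound, ?_⟩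
  rintro T hT (hQ | hQ)
  · exact h.disj_right₁ (hI.complete T hT hQ)
  · exact h.disj_right₂ (hJ.complete T hT hQ)

theorem Covers.exists_mem (h : H.Extends (CFLe L A)) {X : Type*} {F : Set X} (hF : F.Finite)
    {Q : X → Sequent L A → Prop} (hc : ∀ x ∈ F, Covers H p S (Q x)) :
    Covers H p S (fun T => ∃ x ∈ F, Q x T) := by
  induction F, hF using Set.Finite.induction_on with
  | empty => exact Covers.of_false h fun T _ => by simp
  | @insert x F _ _ ih =>
    refine (Covers.or h (hc x (Set.mem_insert x F))
      (ih fun y hy => hc y (Set.mem_insert_of_mem x hy))).mono ?_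
    rintro T - ⟨y, rfl | hy, hQ⟩
    · exact Or.inl hQ
    · exact Or.inr ⟨y, hy, hQ⟩

end Covers

/-- Each such multiset is a submultiset of `F` taken `N` times. -/
theorem _root_.Multiset.finite_setOf_card_le {X : Type*} {F : Set X} (hF : F.Finite) (N : ℕ) :
    {M : Multiset X | (∀ x ∈ M, x ∈ F) ∧ M.card ≤ N}.Finite := by
  classical
  refine (Set.finite_Iic (N • hF.toFinset.val)).subset fun M hM => ?_
  rw [Set.mem_Iic, Multiset.le_iff_count]
  intro x
  by_cases hx : x ∈ M
  · rw [Multiset.count_nsmul, Multiset.count_eq_one_of_mem hF.toFinset.nodup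
      (hF.mem_toFinset.2 (hM.1 x hx)), mul_one]
    exact (Multiset.count_le_card x M).trans hM.2
  · rw [Multiset.count_eq_zero_of_notMem hx]
    exact Nat.zero_le _

/-! ### Instances of semi-analytic rules -/

/-- Choosing arbitrary contexts `C i` for `i ∈ s` gives an instance of a rule of `R` with conclusion
`M · ∏ C i`, where `M` consists of the main formula, and premises `C i · q` for `q ∈ Q i`. -/
structure BlockRule (R : Calculus L A) {n : ℕ} (s : Finset (Fin n)) (M : Sequent L A)
    (Q : Fin n → Multiset (Sequent L A)) : Prop where
  main : ∃ φ, M = left φ ∨ M = right φ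
  free : ∀ p, M.Free p → ∀ i ∈ s, ∀ q ∈ Q i, q.Free p
  inst : ∀ C : Fin n → Sequent L A,
    R.IsInstance (∑ i ∈ s, (Q i).map (C i + ·)) (M + ∑ i ∈ s, C i)

theorem Seq.free_left {p : A} {φ : Formula L.toSig A} : (left φ).Free p ↔ φ.Free p := by
  simp [Seq.Free]

theorem Seq.free_right {p : A} {φ : Formula L.toSig A} : (right φ).Free p ↔ φ.Free p := by
  simp [Seq.Free]

namespace SemiAnalyticData

variable (d : SemiAnalyticData L A)

/-- The contexts of the instance of a semi-analytic rule. -/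
def contexts (σ : Assignment L A) (i : Fin d.n) : Sequent L A := σ.ctx (d.Γ i) ⇒ₛ σ.ctx (d.Δ i)

/-- The sequents `φ̄ ⇒ ψ̄` of the instance of a semi-analytic rule. -/
def instBlocks (σ : Assignment L A) (i : Fin d.n) : Multiset (Sequent L A) :=
  (d.blocks i).map fun q => q.1.map (MetaFormula.inst σ) ⇒ₛ q.2.map (MetaFormula.inst σ)

/-- The assignment with the same formulas as `σ` and with prescribed contexts. -/
noncomputable def withContexts (σ : Assignment L A) (C : Fin d.n → Sequent L A) :
    Assignment L A where
  fml := σ.fml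
  ctx := Function.extend (Sum.elim d.Γ d.Δ)
    (Sum.elim (fun i => (C i).ant) (fun i => (C i).suc)) 0

theorem contexts_withContexts (σ : Assignment L A) (C : Fin d.n → Sequent L A) :
    d.contexts (d.withContexts σ C) = C := by
  funext i
  refine Seq.ext ?_ ?_
  · exact d.distinct.extend_apply (Sum.elim (fun i => (C i).ant) (fun i => (C i).suc)) 0 (.inl i)
  · exact d.distinct.extend_apply (Sum.elim (fun i => (C i).ant) (fun i => (C i).suc)) 0 (.inr i)

theorem bind_fml (σ : Assignment L A) (m : Multiset (MetaFormula L A)) :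
    (m.map MetaItem.fml).bind (MetaItem.inst σ) = m.map (MetaFormula.inst σ) := by
  rw [Multiset.bind_map]
  exact Multiset.bind_singleton _ _

theorem bind_ctx (σ : Assignment L A) {n : ℕ} (X : Fin n → ℕ) :
    (∑ i, ({MetaItem.ctx (X i)} : Multiset (MetaItem L A))).bind (MetaItem.inst σ) =
      ∑ i, σ.ctx (X i) := by
  have h : ∀ m : Multiset (MetaItem L A), m.bind (MetaItem.inst σ) =
    (Multiset.sumAddMonoidHom.comp (Multiset.mapAddMonoidHom (MetaItem.inst σ))) m := fun _ => rfl
  rw [h, map_sum]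
  refine Finset.sum_congr rfl fun i _ => ?_
  rw [← h, Multiset.singleton_bind]
  rfl

theorem premises_map_inst (σ : Assignment L A) :
    d.premises.map (MetaSequent.inst σ) =
      ∑ i, (d.instBlocks σ i).map (d.contexts σ i + ·) := by
  rw [premises, ← Multiset.coe_mapAddMonoidHom, map_sum]
  refine Finset.sum_congr rfl fun i _ => ?_
  rw [Multiset.coe_mapAddMonoidHom, instBlocks, Multiset.map_map, Multiset.map_map]
  refine Multiset.map_congr rfl fun q _ => ?_
  refine Seq.ext ?_ ?_ <;>
  simp [MetaSequent.inst, Multiset.cons_bind, bind_fml, contexts, MetaItem.inst]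

/-- This is where the occurrence condition enters: every atom of an instantiated active formula
already occurs in the instantiated main formula. -/
theorem free_instBlocks (σ : Assignment L A) {p : A}
    (hp : (MetaFormula.inst σ d.main).Free p) (i : Fin d.n) :
    ∀ q ∈ d.instBlocks σ i, q.Free p := by
  intro q' hq'
  obtain ⟨q, hq, rfl⟩ := Multiset.mem_map.1 hq'
  have key : ∀ χ ∈ q.1 + q.2, (MetaFormula.inst σ χ).Free p := by
    intro χ hχ hpχ
    obtain ⟨a, ha, hpa⟩ := (Formula.mem_atoms_subst _ _ _).1 hpχ
    exact hp ((Formula.mem_atoms_subst _ _ _).2 ⟨a, d.occurrence i q hq χ hχ ha, hpa⟩)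
  constructor
  · intro φ hφ
    obtain ⟨χ, hχ, rfl⟩ := Multiset.mem_map.1 hφ
    exact key χ (Multiset.mem_add.2 (Or.inl hχ))
  · intro φ hφ
    obtain ⟨χ, hχ, rfl⟩ := Multiset.mem_map.1 hφ
    exact key χ (Multiset.mem_add.2 (Or.inr hχ))

end SemiAnalyticData

theorem exists_blockRule_univ {R : Calculus L A} {r : Rule L A} (hr : r ∈ R)
    (h : IsLeftSemiAnalytic r ∨ IsRightSemiAnalytic r) (σ : Assignment L A) :
    ∃ (n : ℕ) (M : Sequent L A) (Q : Fin n → Multiset (Sequent L A)) (C : Fin n → Sequent L A),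
      BlockRule R Finset.univ M Q ∧
      r.premises.map (MetaSequent.inst σ) = ∑ i, (Q i).map (C i + ·) ∧
      MetaSequent.inst σ r.concl = M + ∑ i, C i := by
  rcases h with ⟨d, rfl⟩ | ⟨d, rfl⟩
  · have hc : ∀ σ : Assignment L A, MetaSequent.inst σ
        (.fml d.main ::ₘ ∑ i, {.ctx (d.Γ i)} ⇒ₛ ∑ i, {.ctx (d.Δ i)}) =
          left (MetaFormula.inst σ d.main) + ∑ i, d.contexts σ i := by
      intro σ
      refine Seq.ext ?_ ?_
      · simp [MetaSequent.inst, Multiset.cons_bind, SemiAnalyticData.bind_ctx,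
          SemiAnalyticData.contexts, MetaItem.inst]
      · simp [MetaSequent.inst, SemiAnalyticData.bind_ctx, SemiAnalyticData.contexts]
    refine ⟨d.n, left (MetaFormula.inst σ d.main), d.instBlocks σ, d.contexts σ,
      ⟨⟨_, Or.inl rfl⟩, fun p hp i _ => d.free_instBlocks σ (Seq.free_left.1 hp) i, fun C => ?_⟩,
      d.premises_map_inst σ, hc σ⟩
    refine ⟨_, hr, d.withContexts σ C, ?_, ?_⟩
    · rw [d.premises_map_inst, d.contexts_withContexts]
      rfl
    · rw [hc, d.contexts_withContexts]
      rfl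
  · have hc : ∀ σ : Assignment L A, MetaSequent.inst σ
        (∑ i, {.ctx (d.Γ i)} ⇒ₛ .fml d.main ::ₘ ∑ i, {.ctx (d.Δ i)}) =
          right (MetaFormula.inst σ d.main) + ∑ i, d.contexts σ i := by
      intro σ
      refine Seq.ext ?_ ?_
      · simp [MetaSequent.inst, SemiAnalyticData.bind_ctx, SemiAnalyticData.contexts]
      · simp [MetaSequent.inst, Multiset.cons_bind, SemiAnalyticData.bind_ctx,
          SemiAnalyticData.contexts, MetaItem.inst]
    refine ⟨d.n, right (MetaFormula.inst σ d.main), d.instBlocks σ, d.contexts σ,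
      ⟨⟨_, Or.inr rfl⟩, fun p hp i _ => d.free_instBlocks σ (Seq.free_right.1 hp) i, fun C => ?_⟩,
      d.premises_map_inst σ, hc σ⟩
    refine ⟨_, hr, d.withContexts σ C, ?_, ?_⟩
    · rw [d.premises_map_inst, d.contexts_withContexts]
      rfl
    · rw [hc, d.contexts_withContexts]
      rfl

/-- A block without premises may be given the empty context; it then disappears from the instance.
-/
theorem BlockRule.of_univ {R : Calculus L A} {n : ℕ} {M : Sequent L A}
    {Q : Fin n → Multiset (Sequent L A)} (h : BlockRule R Finset.univ M Q) {s : Finset (Fin n)}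
    (hs : ∀ i ∉ s, Q i = 0) : BlockRule R s M Q := by
  classical
  refine ⟨h.main, fun p hp i _ => h.free p hp i (Finset.mem_univ i), fun C => ?_⟩
  convert h.inst (fun i => if i ∈ s then C i else 0) using 1
  · rw [← Finset.sum_subset (Finset.subset_univ s)]
    · exact Finset.sum_congr rfl fun i hi => by simp only [hi, if_true]
    · intro i _ hi
      simp [hs i hi]
  · rw [← Finset.sum_subset (Finset.subset_univ s)]
    · exact congrArg _ (Finset.sum_congr rfl fun i hi => by simp only [hi, if_true])
    · intro i _ hi
      simp [hi]

/-- The blocks without premises can be merged. -/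
theorem exists_merge {n : ℕ} (Q : Fin n → Multiset (Sequent L A)) (C : Fin n → Sequent L A) :
    ∃ (s : Finset (Fin n)) (C' : Fin n → Sequent L A), (∀ i ∉ s, Q i = 0) ∧
      s.card ≤ (∑ i ∈ s, (Q i).card) + 1 ∧ (∀ i, Q i ≠ 0 → C' i = C i) ∧
      ∑ i ∈ s, C' i = ∑ i, C i := by
  classical
  set F : Finset (Fin n) := Finset.univ.filter (fun i => Q i ≠ 0) with hF
  have hFcard : ∀ s, F ⊆ s → F.card ≤ ∑ i ∈ s, (Q i).card := by
    intro s hs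
    refine le_trans ?_ (Finset.sum_le_sum_of_subset hs)
    rw [Finset.card_eq_sum_ones]
    refine Finset.sum_le_sum fun i hi => ?_
    exact Multiset.card_pos.2 (Finset.mem_filter.1 hi).2
  by_cases hE : ∃ i, Q i = 0
  · obtain ⟨i₀, h₀⟩ := hE
    have hi₀ : i₀ ∉ F := by simp [hF, h₀]
    -- One premise-free block `i₀` receives the contexts of all premise-free blocks. It accounts for
    -- the `+ 1` in the bound; every other remaining block has a premise.
    refine ⟨insert i₀ F, fun i => if i = i₀ then ∑ j with Q j = 0, C j else C i, ?_, ?_, ?_, ?_⟩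
    · intro i hi
      by_contra h
      exact hi (Finset.mem_insert_of_mem (Finset.mem_filter.2 ⟨Finset.mem_univ i, h⟩))
    · exact (Finset.card_insert_le _ _).trans
        (Nat.add_le_add_right (hFcard _ (Finset.subset_insert _ _)) 1)
    · intro i hi
      have : i ≠ i₀ := fun e => hi (e ▸ h₀)
      simp [this]
    · rw [Finset.sum_insert hi₀, if_pos rfl, ← Finset.sum_filter_add_sum_filter_not Finset.univ
        (fun i => Q i = 0) C]
      refine congrArg _ (Finset.sum_congr rfl fun i hi => ?_)
      have : i ≠ i₀ := fun e => hi₀ (e ▸ hi)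
      simp [this]
  · have hall : F = Finset.univ := by
      refine Finset.filter_true_of_mem fun i _ h => hE ⟨i, h⟩
    refine ⟨Finset.univ, C, by simp, ?_, fun _ _ => rfl, rfl⟩
    have := hFcard Finset.univ (Finset.subset_univ _)
    rw [hall] at this
    exact this.trans (Nat.le_succ _)

/-- The bound on the number of blocks by the number of premises leaves only finitely many ways to
group a given multiset of premises into blocks. -/
theorem exists_blockRule {R : Calculus L A} {r : Rule L A} (hr : r ∈ R)
    (h : IsLeftSemiAnalytic r ∨ IsRightSemiAnalytic r) (σ : Assignment L A) :
    ∃ (n : ℕ) (s : Finset (Fin n)) (M : Sequent L A) (Q : Fin n → Multiset (Sequent L A))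
      (C : Fin n → Sequent L A),
      BlockRule R s M Q ∧ s.card ≤ (∑ i ∈ s, (Q i).card) + 1 ∧
      r.premises.map (MetaSequent.inst σ) = ∑ i ∈ s, (Q i).map (C i + ·) ∧
      MetaSequent.inst σ r.concl = M + ∑ i ∈ s, C i := by
  obtain ⟨n, M, Q, C, hB, hP, hS⟩ := exists_blockRule_univ hr h σ
  obtain ⟨s, C', h1, h2, h3, h4⟩ := exists_merge Q C
  refine ⟨n, s, M, Q, C', hB.of_univ h1, h2, ?_, by rw [hS, h4]⟩
  rw [hP, ← Finset.sum_subset (Finset.subset_univ s)]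
  · refine Finset.sum_congr rfl fun i _ => ?_
    by_cases hi : Q i = 0
    · simp [hi]
    · rw [h3 i hi]
  · intro i _ hi
    simp [h1 i hi]

/-! ### Covers for the semi-analytic rules. -/

section Cases

variable {G H R : Calculus L A} {p : A} {S : Sequent L A} {J : Sequent L A → Formula L.toSig A}

theorem Calculus.IsAxiomaticExtension.derivable (hAx : H.IsAxiomaticExtension G R)
    {P : Multiset (Sequent L A)} {U : Sequent L A} (hU : R.IsInstance P U)
    (hP : ∀ T ∈ P, H.Derivable T) : H.Derivable U :=
  .step ((hAx P U).2 (Or.inr hU)) hP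

theorem BlockRule.derivable (hAx : H.IsAxiomaticExtension G R) {n : ℕ} {s : Finset (Fin n)}
    {M : Sequent L A} {Q : Fin n → Multiset (Sequent L A)} (hB : BlockRule R s M Q)
    (C : Fin n → Sequent L A) (hC : ∀ i ∈ s, ∀ q ∈ Q i, H.Derivable (C i + q)) :
    H.Derivable (M + ∑ i ∈ s, C i) := by
  refine hAx.derivable (hB.inst C) fun T hT => ?_
  obtain ⟨i, hi, hT⟩ := Multiset.mem_sum.1 hT
  obtain ⟨q, hq, rfl⟩ := Multiset.mem_map.1 hT
  exact hC i hi q hq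

theorem Seq.sum_left {ι : Type*} (s : Finset ι) (f : ι → Formula L.toSig A) :
    ∑ i ∈ s, left (f i) = (s.val.map f ⇒ₛ 0) := by
  have := Multiset.sum_map_singleton (s.val.map f)
  rw [Multiset.map_map] at this
  exact Seq.ext ((Seq.ant_sum s _).trans this) (by simp)

theorem Seq.sum_right {ι : Type*} (s : Finset ι) (f : ι → Formula L.toSig A) :
    ∑ i ∈ s, right (f i) = (0 ⇒ₛ s.val.map f) := by
  have := Multiset.sum_map_singleton (s.val.map f)
  rw [Multiset.map_map] at this
  exact Seq.ext (by simp) ((Seq.suc_sum s _).trans this)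

/-- The family of all `T` such that `S · T` follows by a semi-analytic rule with main formula in
`S`. -/
theorem covers_main_left (h : H.Extends (CFLe L A)) (hAx : H.IsAxiomaticExtension G R)
    (hfin : {P | H.IsInstance P S}.Finite)
    (hJ : ∀ P, H.IsInstance P S → ∀ U ∈ P, IsCover H p U (fun T => H.Derivable (U + T)) (J U)) :
    Covers H p S (fun T => ∃ (n : ℕ) (s : Finset (Fin n)) (M : Sequent L A)
      (Q : Fin n → Multiset (Sequent L A)) (X Y : Fin n → Sequent L A),
      BlockRule R s M Q ∧ s.card ≤ (∑ i ∈ s, (Q i).card) + 1 ∧ S = M + ∑ i ∈ s, X i ∧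
      T = ∑ i ∈ s, Y i ∧ ∀ i ∈ s, ∀ q ∈ Q i, H.Derivable (X i + q + Y i)) := by
  classical
  set c : Multiset (Sequent L A) → Formula L.toSig A := fun b => bigConj L (b.toList.map J) with hc
  -- The family is classified by the grouping `𝓑` of the premises, restricted to S, into blocks.
  -- These restricted premises are those of an inference with conclusion S itself, so termination
  -- leaves finitely many `P`, and each `P` has finitely many groupings.
  have hF : (⋃ P ∈ {P | H.IsInstance P S}, {𝓑 : Multiset (Multiset (Sequent L A)) |
      (∀ b ∈ 𝓑, b ∈ Set.Iic P) ∧ 𝓑.card ≤ P.card + 1}).Finite :=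
    hfin.biUnion fun P _ => Multiset.finite_setOf_card_le (Set.finite_Iic P) _
  refine (Covers.exists_mem h hF (Q := fun 𝓑 T => ∃ (n : ℕ) (s : Finset (Fin n))
      (M : Sequent L A) (Q : Fin n → Multiset (Sequent L A)) (X Y : Fin n → Sequent L A),
      BlockRule R s M Q ∧ 𝓑 = s.val.map (fun i => (Q i).map (X i + ·)) ∧ S = M + ∑ i ∈ s, X i ∧
      T = ∑ i ∈ s, Y i ∧ ∀ i ∈ s, ∀ q ∈ Q i, H.Derivable (X i + q + Y i)) ?_).mono ?_
  · intro 𝓑 _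
    refine Covers.of_exists h ?_
    -- The fixed member supplies one instance realising `𝓑`, which proves soundness. Completeness
    -- below treats arbitrary instances with the same `𝓑`.
    rintro - - ⟨n, s, M, Q, X, -, hB, rfl, hS, -, -⟩
    have hinst : H.IsInstance (∑ i ∈ s, (Q i).map (X i + ·)) S :=
      (hAx _ _).2 (Or.inr (hS ▸ hB.inst X))
    set K : Fin n → Multiset (Sequent L A) := fun i => (Q i).map (X i + ·) with hK
    have hJK : ∀ i ∈ s, ∀ U ∈ K i, IsCover H p U (fun T => H.Derivable (U + T)) (J U) :=
      fun i hi U hU => hJ _ hinst U (Multiset.mem_sum.2 ⟨i, hi, hU⟩)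
    refine ⟨bigFusion L ((s.val.map K).toList.map c), free_bigFusion ?_, h.bigFusion_left ?_, ?_⟩
    · intro φ hφ
      obtain ⟨b, hb, rfl⟩ := List.mem_map.1 hφ
      obtain ⟨i, hi, rfl⟩ := Multiset.mem_map.1 (Multiset.mem_toList.1 hb)
      refine free_bigConj fun φ hφ => ?_
      obtain ⟨U, hU, rfl⟩ := List.mem_map.1 hφ
      exact (hJK i hi U (Multiset.mem_toList.1 hU)).free
    -- Soundness: apply the rule with the block conjunction added to the antecedent context of each
    -- block; the left conjunction rules select the conjunct belonging to the given premise.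
    · rw [← Multiset.map_coe, Multiset.coe_toList, Multiset.map_map, ← Seq.sum_left, hS,
        add_assoc, ← Finset.sum_add_distrib]
      refine hB.derivable hAx _ fun i hi q hq => ?_
      rw [add_right_comm]
      have hU : X i + q ∈ K i := Multiset.mem_map_of_mem _ hq
      exact h.bigConj_left (List.mem_map_of_mem (Multiset.mem_toList.2 hU)) (hJK i hi _ hU).sound
    · rintro T hT ⟨n', s', M', Q', X', Y', hB', hKK, hS', rfl, hprem⟩
      refine h.bigFusion_right (K := fun i => (Q' i).map (X' i + ·)) ?_ fun i hi => ?_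
      · rw [Multiset.coe_toList, hKK]
      · refine h.bigConj_right fun φ hφ => ?_
        obtain ⟨U, hU, rfl⟩ := List.mem_map.1 hφ
        rw [Multiset.mem_toList] at hU
        have hinst' : H.IsInstance (∑ i ∈ s', (Q' i).map (X' i + ·)) S :=
          (hAx _ _).2 (Or.inr (hS' ▸ hB'.inst X'))
        refine (hJ _ hinst' U (Multiset.mem_sum.2 ⟨i, hi, hU⟩)).complete _
          (Seq.free_of_free_sum hT hi) ?_
        obtain ⟨q, hq, rfl⟩ := Multiset.mem_map.1 hU
        exact hprem i hi q hq
  · rintro T - ⟨n, s, M, Q, X, Y, hB, hcard, hS, hT, hprem⟩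
    refine ⟨_, ?_, n, s, M, Q, X, Y, hB, rfl, hS, hT, hprem⟩
    refine Set.mem_biUnion (x := ∑ i ∈ s, (Q i).map (X i + ·))
      ((hAx _ _).2 (Or.inr (hS ▸ hB.inst X))) ⟨?_, ?_⟩
    · intro b hb
      obtain ⟨i, hi, rfl⟩ := Multiset.mem_map.1 hb
      exact Finset.single_le_sum (f := fun i => (Q i).map (X i + ·))
        (fun _ _ => Multiset.zero_le _) hi
    · simpa [Multiset.card_sum] using hcard

/-- The family of all `T` such that `S · T` follows by a semi-analytic rule with main formula in
`T`, and `S` does not lie within one block. -/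
theorem covers_main_right (h : H.Extends (CFLe L A)) (hAx : H.IsAxiomaticExtension G R)
    (hJ : ∀ U : Sequent L A, U.ProperSub S →
      IsCover H p U (fun T => H.Derivable (U + T)) (J U)) :
    Covers H p S (fun T => ∃ (n : ℕ) (s : Finset (Fin n)) (M : Sequent L A)
      (Q : Fin n → Multiset (Sequent L A)) (X Y : Fin n → Sequent L A),
      BlockRule R s M Q ∧ S = ∑ i ∈ s, X i ∧ T = M + ∑ i ∈ s, Y i ∧ (∀ i ∈ s, X i ≠ S) ∧
      ∀ i ∈ s, ∀ q ∈ Q i, H.Derivable (X i + q + Y i)) := by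
  classical
  have hsub : ∀ {n : ℕ} {s : Finset (Fin n)} {X : Fin n → Sequent L A}, S = ∑ i ∈ s, X i →
      ∀ i ∈ s, (X i).ant ≤ S.ant ∧ (X i).suc ≤ S.suc := by
    intro n s X hS i hi
    rw [hS, Seq.ant_sum, Seq.suc_sum]
    exact ⟨Finset.single_le_sum (f := fun i => (X i).ant) (fun _ _ => Multiset.zero_le _) hi,
      Finset.single_le_sum (f := fun i => (X i).suc) (fun _ _ => Multiset.zero_le _) hi⟩
  have hF₀ : {U : Sequent L A | U.ant ≤ S.ant ∧ U.suc ≤ S.suc}.Finite := by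
    refine (((Set.finite_Iic S.ant).prod (Set.finite_Iic S.suc)).image
      (fun m => (m.1 ⇒ₛ m.2))).subset ?_
    rintro U ⟨h1, h2⟩
    exact ⟨(U.ant, U.suc), ⟨h1, h2⟩, rfl⟩
  -- The family is classified by the multiset `𝓜` of nonempty parts into which S is divided. Empty
  -- parts are omitted because their number is not bounded by S; the nonempty ones are at most as
  -- many as the formulas of S.
  refine (Covers.exists_mem h (Multiset.finite_setOf_card_le hF₀ (S.ant.card + S.suc.card))
    (Q := fun 𝓜 T => ∃ (n : ℕ) (s : Finset (Fin n))
      (M : Sequent L A) (Q : Fin n → Multiset (Sequent L A)) (X Y : Fin n → Sequent L A),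
      BlockRule R s M Q ∧ 𝓜 = {i ∈ s | X i ≠ 0}.val.map X ∧ S = ∑ i ∈ s, X i ∧
      T = M + ∑ i ∈ s, Y i ∧ (∀ i ∈ s, X i ≠ S) ∧
      ∀ i ∈ s, ∀ q ∈ Q i, H.Derivable (X i + q + Y i)) ?_).mono ?_
  · intro 𝓜 _
    refine Covers.of_exists h ?_
    rintro - - ⟨n, s, M, Q, X, -, -, rfl, hS, -, hne, -⟩
    have hJX : ∀ U ∈ {i ∈ s | X i ≠ 0}.val.map X,
        IsCover H p U (fun T => H.Derivable (U + T)) (J U) := by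
      intro U hU
      obtain ⟨i, hi, rfl⟩ := Multiset.mem_map.1 hU
      have hi' := (Finset.mem_filter.1 hi).1
      exact hJ _ ⟨(hsub hS i hi').1, (hsub hS i hi').2, hne i hi'⟩
    refine ⟨bigPlus L (({i ∈ s | X i ≠ 0}.val.map X).toList.map J), free_bigPlus ?_, ?_, ?_⟩
    · intro φ hφ
      obtain ⟨U, hU, rfl⟩ := List.mem_map.1 hφ
      exact (hJX U (Multiset.mem_toList.1 hU)).free
    · have := h.bigPlus_left (c := J) (l := ({i ∈ s | X i ≠ 0}.val.map X).toList)
        fun U hU => (hJX U (Multiset.mem_toList.1 hU)).sound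
      rw [Multiset.sum_toList] at this
      change H.Derivable (∑ i ∈ s with X i ≠ 0, X i + _) at this
      rwa [Finset.sum_filter_ne_zero, ← hS] at this
    · rintro T hT ⟨n', s', M', Q', X', Y', hB', hKK, hS', rfl, hne', hprem⟩
      refine h.bigPlus_right ?_
      rw [hKK] at hJX
      -- The rule is applied again with each nonempty part of S replaced by its cover, placed in the
      -- succedent context of the same block.
      rw [← Multiset.map_coe, Multiset.coe_toList, hKK, Multiset.map_map, ← Seq.sum_right,
        Finset.sum_filter, add_assoc, ← Finset.sum_add_distrib]
      obtain ⟨hM, hY⟩ := Seq.free_add.1 hT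
      refine hB'.derivable hAx _ fun i hi q hq => ?_
      have hprem' := hprem i hi q hq
      split_ifs with h0
      · rw [add_right_comm]
        refine (hJX (X' i) (Multiset.mem_map_of_mem _ (Finset.mem_filter.2 ⟨hi, h0⟩))).complete _
          (Seq.free_add.2 ⟨Seq.free_of_free_sum hY hi, hB'.free p hM i hi q hq⟩) ?_
        -- The active formulas are p-free, so `Y' i + q` is an admissible test sequent for the cover
        -- of `X' i`.
        rwa [add_comm (Y' i), ← add_assoc]
      · rw [not_not.1 h0, zero_add, add_comm] at hprem'
        rwa [add_zero]
  · rintro T - ⟨n, s, M, Q, X, Y, hB, hS, hT, hne, hprem⟩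
    refine ⟨_, ⟨?_, ?_⟩, n, s, M, Q, X, Y, hB, rfl, hS, hT, hne, hprem⟩
    · intro U hU
      obtain ⟨i, hi, rfl⟩ := Multiset.mem_map.1 hU
      exact hsub hS i (Finset.mem_filter.1 hi).1
    · have : S.ant.card + S.suc.card = ∑ i ∈ s, ((X i).ant.card + (X i).suc.card) := by
        rw [hS]
        simp [Multiset.card_sum, Finset.sum_add_distrib]
      rw [this, Multiset.card_map, Finset.card_val, Finset.card_eq_sum_ones, Finset.sum_filter]
      refine Finset.sum_le_sum fun i _ => ?_
      split_ifs with h0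
      · by_contra hlt
        refine h0 (Seq.ext ?_ ?_)
        · exact Multiset.card_eq_zero.1 (by omega)
        · exact Multiset.card_eq_zero.1 (by omega)
      · exact Nat.zero_le _

/-- The inference by a semi-analytic rule in which `S` lies within one block. -/
theorem BlockRule.derivable_self (hAx : H.IsAxiomaticExtension G R) {n : ℕ} {s : Finset (Fin n)}
    {M : Sequent L A} {Q : Fin n → Multiset (Sequent L A)} (hB : BlockRule R s M Q)
    {X Y : Fin n → Sequent L A} (hS : S = ∑ i ∈ s, X i) {i₀ : Fin n} (hi₀ : i₀ ∈ s)
    (hX : X i₀ = S) (hprem : ∀ i ∈ s, ∀ q ∈ Q i, H.Derivable (X i + q + Y i))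
    {φ : Formula L.toSig A}
    (ih : ∀ q ∈ Q i₀, H.Derivable (q + Y i₀ + right φ)) :
    H.Derivable (M + ∑ i ∈ s, Y i + right φ) := by
  classical
  rw [← Finset.add_sum_erase s X hi₀, hX] at hS
  have hrest : ∑ i ∈ s.erase i₀, X i = 0 := by
    simpa using hS.symm
  have e : M + ∑ i ∈ s, Y i + right φ =
      M + ∑ i ∈ s, (Y i + if i = i₀ then right φ else 0) := by
    rw [Finset.sum_add_distrib, Finset.sum_ite_eq' s i₀, if_pos hi₀, add_assoc]
  rw [e]
  refine hB.derivable hAx _ fun i hi q hq => ?_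
  split_ifs with hii
  -- Only the block holding S receives `φ`; the other blocks contain nothing of S, so their premises
  -- are already the required ones.
  · subst hii
    convert ih q hq using 1
    abel
  · have := hprem i hi q hq
    rwa [Seq.eq_zero_of_sum_eq_zero hrest (Finset.mem_erase.2 ⟨hii, hi⟩), zero_add, add_comm,
      ← add_zero (Y i)] at this

end Cases

/-! ### The modal rules -/

/-- Used to split a boxed context: the shares of S and of T are boxed multisets again. -/
theorem _root_.Multiset.exists_map_eq_add {X Y : Type*} {f : X → Y} {m : Multiset X}
    {a b : Multiset Y} (h : m.map f = a + b) :
    ∃ m₁ m₂, m = m₁ + m₂ ∧ m₁.map f = a ∧ m₂.map f = b := by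
  classical
  induction a using Multiset.induction_on generalizing m with
  | empty => exact ⟨0, m, by simp, by simp, by simpa using h⟩
  | cons y a ih =>
    rw [Multiset.cons_add] at h
    obtain ⟨x, hx, rfl, hm⟩ := (Multiset.map_eq_cons f m _ y).2 h
    obtain ⟨m₁, m₂, h1, rfl, rfl⟩ := ih hm
    refine ⟨x ::ₘ m₁, m₂, ?_, Multiset.map_cons _ _ _, rfl⟩
    rw [Multiset.cons_add, ← h1, Multiset.cons_erase hx]

theorem _root_.Multiset.singleton_eq_add {X : Type*} {x : X} {a b : Multiset X}
    (h : {x} = a + b) : (a = {x} ∧ b = 0) ∨ (a = 0 ∧ b = {x}) := by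
  have hle : a ≤ {x} := h ▸ Multiset.le_add_right a b
  rcases Multiset.le_singleton.1 hle with rfl | rfl
  · exact Or.inr ⟨rfl, by simpa using h.symm⟩
  · exact Or.inl ⟨rfl, add_eq_left.1 h.symm⟩

section Modal

variable {G H R : Calculus L A} {p : A} {S : Sequent L A} {J : Sequent L A → Formula L.toSig A}
  {b : {c : L.Conn // L.arity c = 1}}

/-- The boxed multiset. -/
abbrev boxed (b : {c : L.Conn // L.arity c = 1}) (Γ : Multiset (Formula L.toSig A)) :
    Multiset (Formula L.toSig A) := Γ.map (Formula.unary b)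

theorem boxed_injective (b : {c : L.Conn // L.arity c = 1}) :
    Function.Injective (boxed (A := A) b) :=
  Multiset.map_injective (Formula.unary_injective b)

theorem free_of_boxed {Γ : Multiset (Formula L.toSig A)} (h : ∀ φ ∈ boxed b Γ, φ.Free p) :
    ∀ φ ∈ Γ, φ.Free p := fun φ hφ =>
  (Formula.free_unary b p φ).1 (h _ (Multiset.mem_map_of_mem _ hφ))

theorem ruleK_premises (b : {c : L.Conn // L.arity c = 1}) (X x : ℕ) (σ : Assignment L A) :
    (ruleK b X x).premises.map (MetaSequent.inst σ) = {σ.ctx X ⇒ₛ {σ.fml x}} := by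
  simp [ruleK, MetaSequent.inst, MetaItem.inst, MetaFormula.inst_var]

theorem ruleK_concl (b : {c : L.Conn // L.arity c = 1}) (X x : ℕ) (σ : Assignment L A) :
    MetaSequent.inst σ (ruleK b X x).concl = (boxed b (σ.ctx X) ⇒ₛ {.unary b (σ.fml x)}) := by
  simp only [ruleK, MetaSequent.inst, Multiset.singleton_bind, MetaItem.inst]
  rfl

theorem ruleD_premises (b : {c : L.Conn // L.arity c = 1}) (X : ℕ) (σ : Assignment L A) :
    (ruleD b X).premises.map (MetaSequent.inst σ) = {σ.ctx X ⇒ₛ 0} := by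
  simp [ruleD, MetaSequent.inst, MetaItem.inst]

theorem ruleD_concl (b : {c : L.Conn // L.arity c = 1}) (X : ℕ) (σ : Assignment L A) :
    MetaSequent.inst σ (ruleD b X).concl = (boxed b (σ.ctx X) ⇒ₛ 0) := by
  simp [ruleD, MetaSequent.inst, MetaItem.inst]

/-- The rule `K` for the modality `b` belongs to `R`. -/
def Calculus.HasK (R : Calculus L A) (b : {c : L.Conn // L.arity c = 1}) : Prop :=
  b ∈ L.box ∧ ∃ X x, ruleK b X x ∈ R

/-- The rules `K` and `D` for the modality `b` belong to `R`. -/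
def Calculus.HasD (R : Calculus L A) (b : {c : L.Conn // L.arity c = 1}) : Prop :=
  R.HasK b ∧ ∃ X, ruleD b X ∈ R

theorem Calculus.HasK.isInstance (h : R.HasK b) (Γ : Multiset (Formula L.toSig A))
    (φ : Formula L.toSig A) :
    R.IsInstance {Γ ⇒ₛ {φ}} (boxed b Γ ⇒ₛ {.unary b φ}) := by
  obtain ⟨-, X, x, hr⟩ := h
  refine ⟨_, hr, ⟨fun _ => φ, fun _ => Γ⟩, ?_, ?_⟩
  · rw [ruleK_premises]
  · rw [ruleK_concl]

theorem Calculus.HasD.isInstance (h : R.HasD b) (Γ : Multiset (Formula L.toSig A)) :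
    R.IsInstance {Γ ⇒ₛ 0} (boxed b Γ ⇒ₛ 0) := by
  obtain ⟨-, X, hr⟩ := h
  refine ⟨_, hr, ⟨fun _ => L.top, fun _ => Γ⟩, ?_, ?_⟩
  · rw [ruleD_premises]
  · rw [ruleD_concl]

theorem Calculus.HasK.derivable (h : R.HasK b) (hAx : H.IsAxiomaticExtension G R)
    {Γ : Multiset (Formula L.toSig A)} {φ : Formula L.toSig A} (hΓ : H.Derivable (Γ ⇒ₛ {φ})) :
    H.Derivable (boxed b Γ ⇒ₛ {.unary b φ}) :=
  hAx.derivable (h.isInstance Γ φ) fun T hT => by rwa [Multiset.mem_singleton.1 hT]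

theorem Calculus.HasD.derivable (h : R.HasD b) (hAx : H.IsAxiomaticExtension G R)
    {Γ : Multiset (Formula L.toSig A)} (hΓ : H.Derivable (Γ ⇒ₛ 0)) :
    H.Derivable (boxed b Γ ⇒ₛ 0) :=
  hAx.derivable (h.isInstance Γ) fun T hT => by rwa [Multiset.mem_singleton.1 hT]

/-- The rule `K` for a sequent written as the product `(Γ ⇒) · (⇒ φ)`. -/
theorem Calculus.HasK.derivable_right (h : R.HasK b) (hAx : H.IsAxiomaticExtension G R)
    {Γ : Multiset (Formula L.toSig A)} {φ : Formula L.toSig A}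
    (hΓ : H.Derivable ((Γ ⇒ₛ 0) + right φ)) :
    H.Derivable ((boxed b Γ ⇒ₛ 0) + right (.unary b φ)) := by
  convert h.derivable hAx (Γ := Γ) (φ := φ) (by convert hΓ using 1; exact Seq.ext (by simp) (by simp))
    using 1
  exact Seq.ext (by simp) (by simp)

/-- The family of all `T` such that `S · T` follows by `K` with the succedent in `S`. -/
theorem covers_K_left (h : H.Extends (CFLe L A)) (hAx : H.IsAxiomaticExtension G R)
    (hJ : ∀ P, H.IsInstance P S → ∀ U ∈ P, IsCover H p U (fun T => H.Derivable (U + T)) (J U)) :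
    Covers H p S (fun T => ∃ b, R.HasK b ∧ ∃ Ξ Γ ψ, S = (boxed b Ξ ⇒ₛ {.unary b ψ}) ∧
      T = (boxed b Γ ⇒ₛ 0) ∧ H.Derivable (Ξ + Γ ⇒ₛ {ψ})) := by
  refine Covers.of_exists h ?_
  rintro - - ⟨b, hK, Ξ, -, ψ, rfl, -, -⟩
  have hI := hJ _ ((hAx _ _).2 (Or.inr (hK.isInstance Ξ ψ))) _ (Multiset.mem_singleton_self _)
  -- K takes Ξ, J ⇒ ψ to □Ξ, □J ⇒ □ψ, and Γ ⇒ J to □Γ ⇒ □J.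
  refine ⟨.unary b (J (Ξ ⇒ₛ {ψ})), (Formula.free_unary _ _ _).2 hI.free, ?_, ?_⟩
  · convert hK.derivable hAx (Γ := Ξ + {J (Ξ ⇒ₛ {ψ})}) (φ := ψ) hI.sound using 1
    exact Seq.ext (by simp) (by simp)
  · rintro T hT ⟨b', hK', Ξ', Γ, ψ', hS, rfl, hprem⟩
    -- There is at most one modality and boxing is injective, so S determines Ξ and ψ and one
    -- formula serves every member of the family.
    obtain rfl := Option.mem_unique hK.1 hK'.1
    simp only [Seq.mk.injEq, Multiset.singleton_inj] at hS
    obtain rfl := boxed_injective b hS.1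
    obtain rfl := Formula.unary_injective b hS.2
    refine hK.derivable_right hAx (hI.complete _ ⟨free_of_boxed hT.1, by simp⟩ ?_)
    convert hprem using 1
    exact Seq.ext (by simp) (by simp)

/-- The family of all `T` such that `S · T` follows by `K` with the succedent in `T`. -/
theorem covers_K_right (h : H.Extends (CFLe L A)) (hAx : H.IsAxiomaticExtension G R)
    (hJ : ∀ b ∈ L.box, ∀ Ξ, S = (boxed b Ξ ⇒ₛ 0) →
      IsCover H p (Ξ ⇒ₛ 0) (fun T => H.Derivable ((Ξ ⇒ₛ 0) + T)) (J (Ξ ⇒ₛ 0))) :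
    Covers H p S (fun T => ∃ b, R.HasK b ∧ ∃ Ξ Γ ψ, S = (boxed b Ξ ⇒ₛ 0) ∧
      T = (boxed b Γ ⇒ₛ {.unary b ψ}) ∧ H.Derivable (Ξ + Γ ⇒ₛ {ψ})) := by
  refine Covers.of_exists h ?_
  rintro - - ⟨b, hK, Ξ, -, -, rfl, -, -⟩
  have hI := hJ b hK.1 Ξ rfl
  -- K allows only one formula in the succedent, so J must pass through it in the antecedent as ¬J:
  -- from Γ ⇒ J, ψ one gets Γ, ¬J ⇒ ψ, then □Γ, □¬J ⇒ □ψ, and finally □Γ ⇒ ¬□¬J, □ψ. Soundness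
  -- passes through □Ξ ⇒ □¬J.
  refine ⟨L.neg (.unary b (L.neg (J (Ξ ⇒ₛ 0)))),
    PropLang.free_neg ((Formula.free_unary _ _ _).2 (PropLang.free_neg hI.free)), ?_, ?_⟩
  · exact h.neg_left (hK.derivable_right hAx (h.neg_right hI.sound))
  · rintro T hT ⟨b', hK', Ξ', Γ, ψ, hS, rfl, hprem⟩
    obtain rfl := Option.mem_unique hK.1 hK'.1
    simp only [Seq.mk.injEq, and_true] at hS
    obtain rfl := boxed_injective b hS
    refine h.neg_right ?_
    have hψ : (Γ ⇒ₛ {ψ}).Free p := ⟨free_of_boxed hT.1, by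
      simpa [Formula.free_unary] using hT.2⟩
    have := h.neg_left (hI.complete _ hψ (by
      convert hprem using 1
      exact Seq.ext (by simp) (by simp)))
    convert hK.derivable hAx (Γ := Γ + {L.neg (J (Ξ ⇒ₛ 0))}) (φ := ψ) this using 1
    exact Seq.ext (by simp) (by simp)

/-- The family of all `T` such that `S · T` follows by `D`. -/
theorem covers_D (h : H.Extends (CFLe L A)) (hAx : H.IsAxiomaticExtension G R)
    (hJ : ∀ b ∈ L.box, ∀ Ξ, S = (boxed b Ξ ⇒ₛ 0) →
      IsCover H p (Ξ ⇒ₛ 0) (fun T => H.Derivable ((Ξ ⇒ₛ 0) + T)) (J (Ξ ⇒ₛ 0))) :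
    Covers H p S (fun T => ∃ b, R.HasD b ∧ ∃ Ξ Γ, S = (boxed b Ξ ⇒ₛ 0) ∧
      T = (boxed b Γ ⇒ₛ 0) ∧ H.Derivable (Ξ + Γ ⇒ₛ 0)) := by
  refine Covers.of_exists h ?_
  rintro - - ⟨b, hD, Ξ, -, rfl, -, -⟩
  have hI := hJ b hD.1.1 Ξ rfl
  refine ⟨.unary b (J (Ξ ⇒ₛ 0)), (Formula.free_unary _ _ _).2 hI.free, ?_, ?_⟩
  · convert hD.derivable hAx (Γ := Ξ + {J (Ξ ⇒ₛ 0)}) hI.sound using 1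
    exact Seq.ext (by simp) (by simp)
  · rintro T hT ⟨b', hD', Ξ', Γ, hS, rfl, hprem⟩
    obtain rfl := Option.mem_unique hD.1.1 hD'.1.1
    simp only [Seq.mk.injEq, and_true] at hS
    obtain rfl := boxed_injective b hS
    -- Soundness used D, but completeness derives □Γ ⇒ □J from Γ ⇒ J by K. This is why D must come
    -- with K.
    refine hD.1.derivable_right hAx (hI.complete _ ⟨free_of_boxed hT.1, by simp⟩ ?_)
    convert hprem using 1
    exact Seq.ext (by simp) (by simp)

end Modal

/-! ### The main theorem -/

section Main

variable {G H R : Calculus L A} {p : A} {S : Sequent L A} {J : Sequent L A → Formula L.toSig A}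

/-- The disjunction of the six covers is fixed before any T is considered, so it can serve unchanged
in an induction on the proof of S·T. That induction handles the one case in which S does not shrink.
-/
theorem exists_isCover_of_below (h : H.Extends (CFLe L A)) (hAx : H.IsAxiomaticExtension G R)
    (hR : R.IsSemiAnalytic) (hfin : {P | H.IsInstance P S}.Finite)
    (hG : Covers H p S (fun T => G.Derivable (S + T)))
    (hJ₁ : ∀ P, H.IsInstance P S → ∀ U ∈ P,
      IsCover H p U (fun T => H.Derivable (U + T)) (J U))
    (hJ₂ : ∀ U : Sequent L A, U.ProperSub S →
      IsCover H p U (fun T => H.Derivable (U + T)) (J U))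
    (hJ₃ : ∀ b ∈ L.box, ∀ Ξ, S = (boxed b Ξ ⇒ₛ 0) →
      IsCover H p (Ξ ⇒ₛ 0) (fun T => H.Derivable ((Ξ ⇒ₛ 0) + T)) (J (Ξ ⇒ₛ 0))) :
    Covers H p S (fun T => H.Derivable (S + T)) := by
  obtain ⟨I, hfree, hsound, hcomp⟩ := Covers.or h hG (Covers.or h (covers_main_left h hAx hfin hJ₁)
    (Covers.or h (covers_main_right h hAx hJ₂) (Covers.or h (covers_K_left h hAx hJ₁)
      (Covers.or h (covers_K_right h hAx hJ₃) (covers_D h hAx hJ₃)))))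
  refine ⟨I, hfree, hsound, fun T hT hST => ?_⟩
  -- S stays fixed in the induction while T varies over p-free sequents.
  generalize hU : S + T = U at hST
  induction hST generalizing T with
  | @step P U hinst hP ih =>
    subst hU
    rcases (hAx _ _).1 hinst with ⟨-, hg⟩ | hinst
    · exact hcomp T hT (Or.inl hg)
    obtain ⟨r, hr, σ, rfl, hconcl⟩ := hinst
    have modal : ∀ b : {c : L.Conn // L.arity c = 1}, ∀ Θ : Multiset (Formula L.toSig A),
        boxed b Θ = S.ant + T.ant →
        ∃ Ξ Γ, Θ = Ξ + Γ ∧ S.ant = boxed b Ξ ∧ T.ant = boxed b Γ := by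
      intro b Θ hΘ
      obtain ⟨Ξ, Γ, h1, h2, h3⟩ := Multiset.exists_map_eq_add hΘ
      exact ⟨Ξ, Γ, h1, h2.symm, h3.symm⟩
    rcases or_assoc.2 (hR.1 r hr) with hblock | ⟨b, hb, ⟨X, x, rfl⟩ | ⟨X, rfl⟩⟩
    · obtain ⟨n, s, M, Q, C, hB, hcard, hPr, hC⟩ := exists_blockRule hr hblock σ
      rw [hC] at hconcl
      rw [hPr] at hP ih
      have hprem : ∀ i ∈ s, ∀ q ∈ Q i, C i + q ∈ ∑ i ∈ s, (Q i).map (C i + ·) :=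
        fun i hi q hq => Multiset.mem_sum.2 ⟨i, hi, Multiset.mem_map_of_mem _ hq⟩
      obtain ⟨S₁, T₁, S₂, T₂, hM, hCS, hS, hT'⟩ := Seq.exists_refinement hconcl.symm
      obtain ⟨X, Y, hXY, rfl, rfl⟩ := Seq.exists_sum_refinement s C hCS
      have hder : ∀ i ∈ s, ∀ q ∈ Q i, H.Derivable (X i + q + Y i) := by
        intro i hi q hq
        have := hP _ (hprem i hi q hq)
        rwa [hXY i hi, add_right_comm] at this
      -- `M` contains a single formula, which therefore lies entirely in S or entirely in T.
      have hside : (S₁ = M ∧ T₁ = 0) ∨ (S₁ = 0 ∧ T₁ = M) := by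
        obtain ⟨φ, rfl | rfl⟩ := hB.main
        · have h0 := add_eq_zero.1 (congrArg Seq.suc hM).symm
          rcases Multiset.singleton_eq_add (congrArg Seq.ant hM) with ⟨h1, h2⟩ | ⟨h1, h2⟩
          · exact Or.inl ⟨Seq.ext h1 h0.1, Seq.ext h2 h0.2⟩
          · exact Or.inr ⟨Seq.ext h1 h0.1, Seq.ext h2 h0.2⟩
        · have h0 := add_eq_zero.1 (congrArg Seq.ant hM).symm
          rcases Multiset.singleton_eq_add (congrArg Seq.suc hM) with ⟨h1, h2⟩ | ⟨h1, h2⟩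
          · exact Or.inl ⟨Seq.ext h0.1 h1, Seq.ext h0.2 h2⟩
          · exact Or.inr ⟨Seq.ext h0.1 h1, Seq.ext h0.2 h2⟩
      rcases hside with ⟨rfl, rfl⟩ | ⟨rfl, rfl⟩
      · rw [zero_add] at hT'
        exact hcomp T hT (Or.inr (Or.inl ⟨n, s, _, Q, X, Y, hB, hcard, hS, hT', hder⟩))
      · rw [zero_add] at hS
        by_cases hne : ∀ i ∈ s, X i ≠ S
        · exact hcomp T hT (Or.inr (Or.inr (Or.inl ⟨n, s, _, Q, X, Y, hB, hS, hT', hne, hder⟩)))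
        · push Not at hne
          obtain ⟨i₀, hi₀, hX⟩ := hne
          rw [hT'] at hT ⊢
          obtain ⟨hTM, hTY⟩ := Seq.free_add.1 hT
          refine hB.derivable_self hAx hS hi₀ hX hder fun q hq => ?_
          -- The premise is S·(q · Y i₀), whose second factor is p-free, so the induction hypothesis
          -- applies to the same S and the same `I`.
          refine ih _ (hprem i₀ hi₀ q hq) (q + Y i₀)
            (Seq.free_add.2 ⟨hB.free p hTM i₀ hi₀ q hq, Seq.free_of_free_sum hTY hi₀⟩) ?_
          rw [hXY i₀ hi₀, hX]
          abel
    · rw [ruleK_concl] at hconcl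
      rw [ruleK_premises] at hP
      have hprem := hP _ (Multiset.mem_singleton_self _)
      have hK : R.HasK b := ⟨hb, X, x, hr⟩
      obtain ⟨Ξ, Γ, hΘ, hSa, hTa⟩ := modal b _ (congrArg Seq.ant hconcl).symm
      rw [hΘ] at hprem
      rcases Multiset.singleton_eq_add (congrArg Seq.suc hconcl).symm with ⟨h1, h2⟩ | ⟨h1, h2⟩
      · exact hcomp T hT (Or.inr (Or.inr (Or.inr (Or.inl
          ⟨b, hK, Ξ, Γ, _, Seq.ext hSa h1, Seq.ext hTa h2, hprem⟩))))
      · exact hcomp T hT (Or.inr (Or.inr (Or.inr (Or.inr (Or.inl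
          ⟨b, hK, Ξ, Γ, _, Seq.ext hSa h1, Seq.ext hTa h2, hprem⟩)))))
    · rw [ruleD_concl] at hconcl
      rw [ruleD_premises] at hP
      have hprem := hP _ (Multiset.mem_singleton_self _)
      have hD : R.HasD b := ⟨⟨hb, hR.2 b hb ⟨X, hr⟩⟩, X, hr⟩
      obtain ⟨Ξ, Γ, hΘ, hSa, hTa⟩ := modal b _ (congrArg Seq.ant hconcl).symm
      rw [hΘ] at hprem
      obtain ⟨h1, h2⟩ := add_eq_zero.1 (congrArg Seq.suc hconcl)
      exact hcomp T hT (Or.inr (Or.inr (Or.inr (Or.inr (Or.inr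
        ⟨b, hD, Ξ, Γ, Seq.ext hSa h1, Seq.ext hTa h2, hprem⟩)))))

/-- Well-founded induction on S: the three clauses of the terminating order provide the covers of
premises, of proper subsequents and of unboxed sequents. -/
theorem covers_derivable (h : H.Extends (CFLe L A)) (hTerm : H.IsTerminating)
    (hR : R.IsSemiAnalytic) (hAx : H.IsAxiomaticExtension G R)
    (hG : G.HasStrongUniformInterpolation H) (p : A) (S : Sequent L A) :
    Covers H p S (fun T => H.Derivable (S + T)) := by
  classical
  obtain ⟨hfin, lt, hwf, -, hprem, hsub, hbox⟩ := hTerm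
  induction S using hwf.induction with
  | h S ih =>
  -- The empty sequent is treated apart: its void inference by D does not descend, and unboxing it
  -- changes nothing. Here S·T is T, so 0 is a cover by the rules for 0.
  by_cases hS : S = 0
  · subst hS
    refine ⟨L.zero, L.free_zero, by simpa using h.zero_left, fun T _ hT => h.zero_right ?_⟩
    simpa using hT
  let J : Sequent L A → Formula L.toSig A := fun U => if hU : lt U S then (ih U hU).choose else L.top
  have hJ : ∀ U, lt U S → IsCover H p U (fun T => H.Derivable (U + T)) (J U) := by
    intro U hU
    simp only [J, dif_pos hU]
    exact (ih U hU).choose_spec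
  refine exists_isCover_of_below (J := J) h hAx hR (hfin S) ?_ ?_ ?_ ?_
  · obtain ⟨I, hI⟩ := (hG S S p).1
    exact ⟨I, isStrongLeftInterpolant_iff.1 hI⟩
  · exact fun P hP U hU => hJ U (hprem P S hP U hU fun h0 => hS h0.2)
  · exact fun U hU => hJ U (hsub S U hU)
  · rintro b hb Ξ rfl
    refine hJ _ ?_
    have hΞ : Ξ + 0 ≠ 0 := by
      rintro h0
      rw [add_zero] at h0
      exact hS (by rw [h0]; rfl)
    simpa using hbox b hb 0 Ξ 0 0 hΞ

end Main

end MultiSequent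

theorem mainTheorem6 {L : MultiSequent.PropLang.{u}} {A : Type v}
    (G H R : MultiSequent.Calculus L A)
    (hCFLe : H.Extends (MultiSequent.CFLe L A))
    (hTerm : H.IsTerminating)
    (hR : R.IsSemiAnalytic)
    (hAx : H.IsAxiomaticExtension G R)
    (hG : G.HasStrongUniformInterpolation H) :
    H.HasStrongUniformInterpolation H ∧
      ∀ (S : MultiSequent.Sequent L A) (p : A), ∃ I : MultiSequent.Formula L.toSig A,
        MultiSequent.IsStrongLeftInterpolant H H p S I ∧
          MultiSequent.IsStrongRightInterpolant H H p S (L.neg I) := by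
  have key : ∀ (S : MultiSequent.Sequent L A) (p : A), ∃ I : MultiSequent.Formula L.toSig A,
      MultiSequent.IsStrongLeftInterpolant H H p S I ∧
        MultiSequent.IsStrongRightInterpolant H H p S (L.neg I) := by
    intro S p
    obtain ⟨I, hI⟩ := MultiSequent.covers_derivable hCFLe hTerm hR hAx hG p S
    have hI' := MultiSequent.isStrongLeftInterpolant_iff.2 hI
    exact ⟨I, hI', hI'.neg hCFLe⟩
  refine ⟨fun S T p => ⟨?_, ?_⟩, key⟩
  · obtain ⟨I, hI, -⟩ := key S p
    exact ⟨I, hI⟩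
  · obtain ⟨I, -, hI⟩ := key T p
    exact ⟨_, hI⟩
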